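/- Let $m,n$ be integers with $2\le m<\frac n2$, let $u\colon\mathbb R^n\to(0,\infty)$ be a smooth function, and let $g=u^{\frac{4}{n-2m}}|dx|^2$ be the corresponding conformal metric on $\mathbb R^n$. For $1\le k\le m$ let the $2k$-order Q-curvature $Q^{(2k)}_g$ of $g$ be the function defined by $$(-\Delta)^k\Big(u^{\frac{n-2k}{n-2m}}\Big)=Q^{(2k)}_g\,u^{\frac{n+2k}{n-2m}}\quad\text{on }\mathbb R^n,$$ where $\Delta$ is the Euclidean Laplacian; for $k=m$ this reads $(-\Delta)^m u=Q^{(2m)}_g u^{\frac{n+2m}{n-2m}}$. Suppose that $Q^{(2m)}_g>0$ on $\mathbb R^n$ and that, for some real number $s$ with $-2m<s\le 0$, there is a constant $c_0>0$ such that $Q^{(2m)}_g(x)\ge c_0|x|^s$ for all sufficiently large $|x|$. Then, at every point of $\mathbb R^n$, the scalar curvature $R_g$ of $g$ (a positive constant multiple of $Q^{(2)}_g$, so that also $Q^{(2)}_g>0$) and the 4th-order Q-curvature $Q^{(4)}_g$ are strictly positive. -/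

import Mathlib

open scoped ContDiff

noncomputable section

namespace ConformalQ

/-- Euclidean `n`-space. -/
abbrev E (n : ℕ) : Type := EuclideanSpace ℝ (Fin n)

/-- The partial derivative `∂ f / ∂ xᵢ` of a real function on `ℝⁿ`. -/
def partialDeriv {n : ℕ} (i : Fin n) (f : E n → ℝ) (x : E n) : ℝ :=
  fderiv ℝ f x (EuclideanSpace.single i 1)

/-- The Christoffel symbol `Γᵏᵢⱼ = ½ ∑ₗ gᵏˡ (∂ᵢ gⱼₗ + ∂ⱼ gᵢₗ - ∂ₗ gᵢⱼ)` of a Riemannian metric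
`G = (gᵢⱼ)` on `ℝⁿ`, given by its coefficient matrix in the standard coordinates. -/
def christoffel {n : ℕ} (G : E n → Matrix (Fin n) (Fin n) ℝ) (k i j : Fin n) (x : E n) : ℝ :=
  (1 / 2) * ∑ l : Fin n, (G x)⁻¹ k l *
    (partialDeriv i (fun y => G y j l) x + partialDeriv j (fun y => G y i l) x
      - partialDeriv l (fun y => G y i j) x)

/-- The Ricci tensor
`Ricᵢⱼ = ∑ₖ (∂ₖ Γᵏᵢⱼ - ∂ⱼ Γᵏᵢₖ + ∑ₗ (Γᵏₖₗ Γˡᵢⱼ - Γᵏⱼₗ Γˡᵢₖ))` of a metric on `ℝⁿ`. -/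
def ricci {n : ℕ} (G : E n → Matrix (Fin n) (Fin n) ℝ) (i j : Fin n) (x : E n) : ℝ :=
  ∑ k : Fin n, (partialDeriv k (christoffel G k i j) x - partialDeriv j (christoffel G k i k) x
    + ∑ l : Fin n, (christoffel G k k l x * christoffel G l i j x
      - christoffel G k j l x * christoffel G l i k x))

/-- The scalar curvature `R = ∑ᵢⱼ gⁱʲ Ricᵢⱼ` of a metric on `ℝⁿ` (positive on round spheres). -/
def scalarCurvature {n : ℕ} (G : E n → Matrix (Fin n) (Fin n) ℝ) (x : E n) : ℝ :=
  ∑ i : Fin n, ∑ j : Fin n, (G x)⁻¹ i j * ricci G i j x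

/-- The conformal metric `g = u^{4/(n-2m)} |dx|²` on `ℝⁿ`, as a matrix of coefficients. -/
def conformalMetric (n m : ℕ) (u : E n → ℝ) (x : E n) : Matrix (Fin n) (Fin n) ℝ :=
  (u x ^ (4 / ((n : ℝ) - 2 * m))) • (1 : Matrix (Fin n) (Fin n) ℝ)

/-- The operator `-Δ` on real functions on `ℝⁿ`. -/
def negLaplacian {n : ℕ} (f : E n → ℝ) : E n → ℝ :=
  fun x => -(Laplacian.laplacian f x)

/-- The `2k`-order Q-curvature of the metric `g = u^{4/(n-2m)} |dx|²` on `ℝⁿ`, that is, the function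
`Q` with `(-Δ)ᵏ (u^{(n-2k)/(n-2m)}) = Q u^{(n+2k)/(n-2m)}`. For `k = m` the equation is
`(-Δ)ᵐ u = Q u^{(n+2m)/(n-2m)}`. -/
def qCurvature (n m k : ℕ) (u : E n → ℝ) (x : E n) : ℝ :=
  negLaplacian^[k] (fun y => u y ^ (((n : ℝ) - 2 * k) / ((n : ℝ) - 2 * m))) x
    / u x ^ (((n : ℝ) + 2 * k) / ((n : ℝ) - 2 * m))

/-- The defining equation of the `2k`-order Q-curvature. -/
theorem negLaplacian_iterate_eq (n m k : ℕ) (u : E n → ℝ) (hu : ∀ x, 0 < u x) (x : E n) :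
    negLaplacian^[k] (fun y => u y ^ (((n : ℝ) - 2 * k) / ((n : ℝ) - 2 * m))) x
      = qCurvature n m k u x * u x ^ (((n : ℝ) + 2 * k) / ((n : ℝ) - 2 * m)) :=
  (div_mul_cancel₀ _ (Real.rpow_pos_of_pos (hu x) _).ne').symm

/-- `Q` has slow decay barrier with rate `s` at infinity: there is a constant `c₀ > 0` such that
`Q(x) ≥ c₀ |x|^s` for all sufficiently large `|x|`. -/
def HasSlowDecayBarrier {n : ℕ} (Q : E n → ℝ) (s : ℝ) : Prop :=
  ∃ c₀ : ℝ, 0 < c₀ ∧ ∃ R : ℝ, ∀ x : E n, R ≤ ‖x‖ → c₀ * ‖x‖ ^ s ≤ Q x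

end ConformalQ

end

/-! Put `a = n - 2m`, `p = (n + 2m)/(n - 2m)` and `f = (-Δ)^m u = Q u^p`. After a translation only
the origin matters. The plan is to show that `u` is a Riesz potential of `f`, and then to read both
curvatures as moment inequalities.

Testing the equation against rescaled bumps, `p > 1` and `s > -2m` force the averages of `u` over
balls of radius `R` to tend to 0 (`integral_le_of_superlinear`). Hence, when `f` is paired with
truncations of the polyharmonic kernel `|z|^(-a)`, nothing survives from infinity, and `C ∂^l u(0) =
± ∫ f ∂^l |z|^(-a)` for all orders below `2m` (`riesz_representation`).

With the positive density `w = f |z|^(-a) / C` and the inverted point `y = z/|z|²`, derivatives of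
the kernel are the kernel times polynomials in `y`. So derivatives of `u` at 0 are moments of `y`
(`exists_weight`). Both the scalar curvature and `Q⁽²⁾` have the sign of `-u Δu - (2m-2)/a |∇u|²`, a
positive multiple of the variance of `y` (`exists_moments`). For `Q⁽⁴⁾` with `m ≥ 3`, centring `y`
at its mean removes every gradient term and leaves a fourth central moment plus squares, all with
positive coefficients (`quartic_pos`). For `m = 2`, `Q⁽⁴⁾` is the curvature assumed positive. -/

noncomputable section

namespace ConformalQ

open MeasureTheory Filter Topology

/-! ### Calculus of iterated derivatives and of `(-Δ)^k`, up to integration by parts. -/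

section DirectionalDerivatives

/-! ### Iterated directional derivatives -/

/-- The directional derivative `∂ᵥ f`. -/
def dirDeriv {n : ℕ} (v : E n) (f : E n → ℝ) (x : E n) : ℝ := fderiv ℝ f x v

/-- The iterated directional derivative along the vectors of a list. -/
def dirDerivs {n : ℕ} (l : List (E n)) (f : E n → ℝ) : E n → ℝ := l.foldr dirDeriv f

/-- The standard basis vectors. -/
abbrev stdVec {n : ℕ} (i : Fin n) : E n := EuclideanSpace.single i 1

variable {n : ℕ}

@[simp] lemma dirDerivs_nil (f : E n → ℝ) : dirDerivs [] f = f := rfl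

@[simp] lemma dirDerivs_cons (v : E n) (l : List (E n)) (f : E n → ℝ) :
    dirDerivs (v :: l) f = dirDeriv v (dirDerivs l f) := rfl

lemma contDiff_dirDeriv {f : E n → ℝ} (hf : ContDiff ℝ ∞ f) (v : E n) :
    ContDiff ℝ ∞ (dirDeriv v f) :=
  (hf.fderiv_right (m := ∞) (by simp)).clm_apply contDiff_const

lemma contDiff_dirDerivs {f : E n → ℝ} (hf : ContDiff ℝ ∞ f) (l : List (E n)) :
    ContDiff ℝ ∞ (dirDerivs l f) := by
  induction l with
  | nil => exact hf
  | cons v l ih => exact contDiff_dirDeriv ih v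

lemma dirDeriv_eventuallyEq {f g : E n → ℝ} {x : E n} (h : f =ᶠ[𝓝 x] g) (v : E n) :
    dirDeriv v f =ᶠ[𝓝 x] dirDeriv v g := by
  filter_upwards [h.fderiv (𝕜 := ℝ)] with y hy
  simp [dirDeriv, hy]

lemma dirDerivs_eventuallyEq {f g : E n → ℝ} {x : E n} (h : f =ᶠ[𝓝 x] g) (l : List (E n)) :
    dirDerivs l f =ᶠ[𝓝 x] dirDerivs l g := by
  induction l with
  | nil => exact h
  | cons v l ih => exact dirDeriv_eventuallyEq ih v

lemma dirDeriv_zero (v : E n) : dirDeriv v (fun _ => (0 : ℝ)) = fun _ => 0 := by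
  ext x; simp [dirDeriv]

lemma dirDerivs_zero (l : List (E n)) : dirDerivs l (fun _ => (0 : ℝ)) = fun _ => 0 := by
  induction l with
  | nil => rfl
  | cons v l ih => rw [dirDerivs_cons, ih, dirDeriv_zero]

lemma dirDeriv_add {f g : E n → ℝ} (hf : ContDiff ℝ ∞ f) (hg : ContDiff ℝ ∞ g) (v : E n) :
    dirDeriv v (fun x => f x + g x) = fun x => dirDeriv v f x + dirDeriv v g x := by
  ext x
  simp [dirDeriv, fderiv_fun_add (hf.differentiable (by simp) x) (hg.differentiable (by simp) x)]

lemma dirDeriv_sub {f g : E n → ℝ} (hf : ContDiff ℝ ∞ f) (hg : ContDiff ℝ ∞ g) (v : E n) :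
    dirDeriv v (fun x => f x - g x) = fun x => dirDeriv v f x - dirDeriv v g x := by
  ext x
  simp [dirDeriv, fderiv_fun_sub (hf.differentiable (by simp) x) (hg.differentiable (by simp) x)]

lemma dirDeriv_neg (f : E n → ℝ) (v : E n) :
    dirDeriv v (fun x => -f x) = fun x => -dirDeriv v f x := by
  ext x
  simp [dirDeriv, fderiv_fun_neg]

lemma dirDeriv_const_mul {f : E n → ℝ} (hf : ContDiff ℝ ∞ f) (c : ℝ) (v : E n) :
    dirDeriv v (fun x => c * f x) = fun x => c * dirDeriv v f x := by
  ext x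
  simp [dirDeriv, fderiv_const_mul (hf.differentiable (by simp) x)]

lemma dirDeriv_mul {f g : E n → ℝ} (hf : ContDiff ℝ ∞ f) (hg : ContDiff ℝ ∞ g) (v : E n) :
    dirDeriv v (fun x => f x * g x) = fun x => f x * dirDeriv v g x + dirDeriv v f x * g x := by
  ext x
  simp [dirDeriv, fderiv_fun_mul (hf.differentiable (by simp) x) (hg.differentiable (by simp) x)]
  ring

lemma dirDeriv_sum {ι : Type*} (s : Finset ι) {f : ι → E n → ℝ}
    (hf : ∀ i ∈ s, ContDiff ℝ ∞ (f i)) (v : E n) :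
    dirDeriv v (fun x => ∑ i ∈ s, f i x) = fun x => ∑ i ∈ s, dirDeriv v (f i) x := by
  ext x
  simp [dirDeriv, fderiv_fun_sum fun i hi => (hf i hi).differentiable (by simp) x]

lemma dirDeriv_comm {f : E n → ℝ} (hf : ContDiff ℝ ∞ f) (v w : E n) :
    dirDeriv v (dirDeriv w f) = dirDeriv w (dirDeriv v f) := by
  have key (v w : E n) (x : E n) : dirDeriv v (dirDeriv w f) x = fderiv ℝ (fderiv ℝ f) x v w := by
    have h : DifferentiableAt ℝ (fderiv ℝ f) x :=
      (hf.fderiv_right (m := ∞) (by simp)).differentiable (by simp) x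
    change fderiv ℝ (fun y => fderiv ℝ f y w) x v = _
    rw [fderiv_clm_apply h (by fun_prop)]
    simp
  ext x
  rw [key, key]
  exact (hf.contDiffAt.isSymmSndFDerivAt (by simpa using ENat.LEInfty.out)).eq v w

/-- Mixed partials commute, so a list of directions matters only as a multiset. -/
lemma dirDerivs_perm {f : E n → ℝ} (hf : ContDiff ℝ ∞ f) {l l' : List (E n)} (h : l.Perm l') :
    dirDerivs l f = dirDerivs l' f := by
  induction h with
  | nil => rfl
  | cons v _ ih => rw [dirDerivs_cons, ih]; rfl
  | swap v w l => exact dirDeriv_comm (contDiff_dirDerivs hf l) w v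
  | trans _ _ ih₁ ih₂ => exact ih₁.trans ih₂

lemma dirDerivs_sub {f g : E n → ℝ} (hf : ContDiff ℝ ∞ f) (hg : ContDiff ℝ ∞ g)
    (l : List (E n)) :
    dirDerivs l (fun x => f x - g x) = fun x => dirDerivs l f x - dirDerivs l g x := by
  induction l with
  | nil => rfl
  | cons v l ih =>
    rw [dirDerivs_cons, ih, dirDeriv_sub (contDiff_dirDerivs hf l) (contDiff_dirDerivs hg l)]
    rfl

lemma dirDerivs_const_mul {f : E n → ℝ} (hf : ContDiff ℝ ∞ f) (c : ℝ) (l : List (E n)) :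
    dirDerivs l (fun x => c * f x) = fun x => c * dirDerivs l f x := by
  induction l with
  | nil => rfl
  | cons v l ih =>
    rw [dirDerivs_cons, ih, dirDeriv_const_mul (contDiff_dirDerivs hf l)]
    rfl

lemma dirDerivs_comp_smul {f : E n → ℝ} (hf : ContDiff ℝ ∞ f) (c : ℝ) (l : List (E n)) :
    dirDerivs l (fun x => f (c • x)) = fun x => c ^ l.length * dirDerivs l f (c • x) := by
  induction l with
  | nil => simp
  | cons v l ih =>
    have h := contDiff_dirDerivs hf l
    rw [dirDerivs_cons, ih, dirDeriv_const_mul (by fun_prop)]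
    ext x
    have : dirDeriv v (fun x => dirDerivs l f (c • x)) x = c * dirDeriv v (dirDerivs l f) (c • x) := by
      simp only [dirDeriv]
      rw [fderiv_comp_smul]
      simp
    rw [this, dirDerivs_cons, List.length_cons]
    ring

lemma dirDeriv_comp_add (f : E n → ℝ) (v y : E n) :
    dirDeriv v (fun x => f (x + y)) = fun x => dirDeriv v f (x + y) := by
  ext x
  simp only [dirDeriv]
  rw [fderiv_comp_add_right]

lemma dirDerivs_comp_add (f : E n → ℝ) (y : E n) (l : List (E n)) :
    dirDerivs l (fun x => f (x + y)) = fun x => dirDerivs l f (x + y) := by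
  induction l with
  | nil => rfl
  | cons v l ih => rw [dirDerivs_cons, ih, dirDeriv_comp_add]; rfl

lemma hasCompactSupport_dirDerivs {f : E n → ℝ} (hf : HasCompactSupport f) (l : List (E n)) :
    HasCompactSupport (dirDerivs l f) := by
  induction l with
  | nil => exact hf
  | cons v l ih => exact ih.fderiv_apply ℝ v

/-! ### The Laplacian -/

lemma laplacian_eq_sum {f : E n → ℝ} (hf : ContDiff ℝ ∞ f) :
    Laplacian.laplacian f = fun x => ∑ i, dirDeriv (stdVec i) (dirDeriv (stdVec i) f) x := by
  rw [InnerProductSpace.laplacian_eq_iteratedFDeriv_orthonormalBasis f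
    (EuclideanSpace.basisFun (Fin n) ℝ)]
  ext x
  refine Finset.sum_congr rfl fun i _ => ?_
  have h : DifferentiableAt ℝ (fderiv ℝ f) x :=
    (hf.fderiv_right (m := ∞) (by simp)).differentiable (by simp) x
  rw [iteratedFDeriv_two_apply]
  change _ = fderiv ℝ (fun y => fderiv ℝ f y (stdVec i)) x (stdVec i)
  rw [fderiv_clm_apply h (by fun_prop)]
  simp [EuclideanSpace.basisFun_apply]

lemma negLaplacian_eq_sum {f : E n → ℝ} (hf : ContDiff ℝ ∞ f) :
    negLaplacian f = fun x => -∑ i, dirDeriv (stdVec i) (dirDeriv (stdVec i) f) x := by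
  ext x
  rw [negLaplacian, laplacian_eq_sum hf]

lemma contDiff_negLaplacian {f : E n → ℝ} (hf : ContDiff ℝ ∞ f) :
    ContDiff ℝ ∞ (negLaplacian f) := by
  rw [negLaplacian_eq_sum hf]
  exact (ContDiff.sum fun i _ => contDiff_dirDeriv (contDiff_dirDeriv hf _) _).neg

lemma contDiff_negLaplacian_iterate {f : E n → ℝ} (hf : ContDiff ℝ ∞ f) (k : ℕ) :
    ContDiff ℝ ∞ (negLaplacian^[k] f) := by
  induction k with
  | zero => exact hf
  | succ k ih => rw [Function.iterate_succ_apply']; exact contDiff_negLaplacian ih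

lemma negLaplacian_eventuallyEq {f g : E n → ℝ} {x : E n} (h : f =ᶠ[𝓝 x] g) :
    negLaplacian f =ᶠ[𝓝 x] negLaplacian g := by
  filter_upwards [InnerProductSpace.laplacian_congr_nhds h] with y hy
  simp [negLaplacian, hy]

lemma negLaplacian_sub {f g : E n → ℝ} (hf : ContDiff ℝ ∞ f) (hg : ContDiff ℝ ∞ g) :
    negLaplacian (fun x => f x - g x) = fun x => negLaplacian f x - negLaplacian g x := by
  rw [negLaplacian_eq_sum hf, negLaplacian_eq_sum hg, negLaplacian_eq_sum (hf.sub hg)]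
  ext x
  simp_rw [dirDeriv_sub hf hg, dirDeriv_sub (contDiff_dirDeriv hf _) (contDiff_dirDeriv hg _)]
  rw [Finset.sum_sub_distrib]
  ring

lemma negLaplacian_const_mul {f : E n → ℝ} (hf : ContDiff ℝ ∞ f) (c : ℝ) :
    negLaplacian (fun x => c * f x) = fun x => c * negLaplacian f x := by
  rw [negLaplacian_eq_sum hf, negLaplacian_eq_sum (contDiff_const.mul hf)]
  ext x
  simp_rw [dirDeriv_const_mul hf, dirDeriv_const_mul (contDiff_dirDeriv hf _)]
  rw [← Finset.mul_sum]
  ring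

lemma negLaplacian_comp_smul {f : E n → ℝ} (hf : ContDiff ℝ ∞ f) (c : ℝ) :
    negLaplacian (fun x => f (c • x)) = fun x => c ^ 2 * negLaplacian f (c • x) := by
  have h : ContDiff ℝ ∞ fun x => f (c • x) := by fun_prop
  rw [negLaplacian_eq_sum hf, negLaplacian_eq_sum h]
  ext x
  have (i : Fin n) := congrFun (dirDerivs_comp_smul hf c [stdVec i, stdVec i]) x
  simp only [dirDerivs_cons, dirDerivs_nil, List.length_cons, List.length_nil] at this
  simp_rw [this]
  rw [← Finset.mul_sum]
  ring

lemma negLaplacian_comp_add {f : E n → ℝ} (hf : ContDiff ℝ ∞ f) (y : E n) :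
    negLaplacian (fun x => f (x + y)) = fun x => negLaplacian f (x + y) := by
  have h : ContDiff ℝ ∞ fun x => f (x + y) := by fun_prop
  rw [negLaplacian_eq_sum hf, negLaplacian_eq_sum h]
  ext x
  simp_rw [dirDeriv_comp_add]

lemma negLaplacian_iterate_sub {f g : E n → ℝ} (hf : ContDiff ℝ ∞ f) (hg : ContDiff ℝ ∞ g)
    (k : ℕ) : negLaplacian^[k] (fun x => f x - g x) =
      fun x => negLaplacian^[k] f x - negLaplacian^[k] g x := by
  induction k with
  | zero => rfl
  | succ k ih =>
    simp_rw [Function.iterate_succ_apply', ih]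
    exact negLaplacian_sub (contDiff_negLaplacian_iterate hf k) (contDiff_negLaplacian_iterate hg k)

lemma negLaplacian_iterate_const_mul {f : E n → ℝ} (hf : ContDiff ℝ ∞ f) (c : ℝ) (k : ℕ) :
    negLaplacian^[k] (fun x => c * f x) = fun x => c * negLaplacian^[k] f x := by
  induction k with
  | zero => rfl
  | succ k ih =>
    simp_rw [Function.iterate_succ_apply', ih]
    exact negLaplacian_const_mul (contDiff_negLaplacian_iterate hf k) c

lemma negLaplacian_iterate_comp_smul {f : E n → ℝ} (hf : ContDiff ℝ ∞ f) (c : ℝ) (k : ℕ) :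
    negLaplacian^[k] (fun x => f (c • x)) = fun x => c ^ (2 * k) * negLaplacian^[k] f (c • x) := by
  induction k with
  | zero => simp
  | succ k ih =>
    have h := contDiff_negLaplacian_iterate hf k
    simp_rw [Function.iterate_succ_apply', ih]
    rw [negLaplacian_const_mul (by fun_prop), negLaplacian_comp_smul h]
    ext x
    ring

lemma negLaplacian_iterate_comp_add {f : E n → ℝ} (hf : ContDiff ℝ ∞ f) (y : E n) (k : ℕ) :
    negLaplacian^[k] (fun x => f (x + y)) = fun x => negLaplacian^[k] f (x + y) := by
  induction k with
  | zero => simp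
  | succ k ih =>
    simp_rw [Function.iterate_succ_apply', ih]
    exact negLaplacian_comp_add (contDiff_negLaplacian_iterate hf k) y

lemma negLaplacian_dirDeriv {f : E n → ℝ} (hf : ContDiff ℝ ∞ f) (v : E n) :
    negLaplacian (dirDeriv v f) = dirDeriv v (negLaplacian f) := by
  rw [negLaplacian_eq_sum hf, negLaplacian_eq_sum (contDiff_dirDeriv hf v), dirDeriv_neg,
    dirDeriv_sum _ fun i _ => contDiff_dirDeriv (contDiff_dirDeriv hf _) _]
  ext x
  simp_rw [dirDeriv_comm hf _ v, dirDeriv_comm (contDiff_dirDeriv hf _) _ v]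

lemma negLaplacian_iterate_dirDeriv {f : E n → ℝ} (hf : ContDiff ℝ ∞ f) (v : E n) (k : ℕ) :
    negLaplacian^[k] (dirDeriv v f) = dirDeriv v (negLaplacian^[k] f) := by
  induction k with
  | zero => rfl
  | succ k ih =>
    simp_rw [Function.iterate_succ_apply', ih]
    exact negLaplacian_dirDeriv (contDiff_negLaplacian_iterate hf k) v

lemma negLaplacian_iterate_dirDerivs {f : E n → ℝ} (hf : ContDiff ℝ ∞ f) (l : List (E n)) (k : ℕ) :
    negLaplacian^[k] (dirDerivs l f) = dirDerivs l (negLaplacian^[k] f) := by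
  induction l with
  | nil => rfl
  | cons v l ih =>
    rw [dirDerivs_cons, negLaplacian_iterate_dirDeriv (contDiff_dirDerivs hf l), ih]
    rfl

lemma hasCompactSupport_negLaplacian {f : E n → ℝ} (hs : HasCompactSupport f) :
    HasCompactSupport (negLaplacian f) := by
  refine hs.mono' fun x hx => ?_
  contrapose! hx
  have h : f =ᶠ[𝓝 x] fun _ => 0 := notMem_tsupport_iff_eventuallyEq.1 hx
  have := (negLaplacian_eventuallyEq h).eq_of_nhds
  rw [Function.mem_support, not_not, this, negLaplacian_eq_sum contDiff_const]
  simp [dirDeriv_zero]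

lemma hasCompactSupport_negLaplacian_iterate {f : E n → ℝ} (hs : HasCompactSupport f) (k : ℕ) :
    HasCompactSupport (negLaplacian^[k] f) := by
  induction k with
  | zero => exact hs
  | succ k ih => rw [Function.iterate_succ_apply']; exact hasCompactSupport_negLaplacian ih

/-! ### Integration by parts -/

lemma integral_mul_dirDeriv {f g : E n → ℝ} (hf : ContDiff ℝ ∞ f) (hg : ContDiff ℝ ∞ g)
    (hs : HasCompactSupport g) (v : E n) :
    ∫ x, f x * dirDeriv v g x = -∫ x, dirDeriv v f x * g x := by
  have hg' : HasCompactSupport (dirDeriv v g) := hs.fderiv_apply ℝ v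
  refine integral_mul_fderiv_eq_neg_fderiv_mul_of_integrable ?_ ?_ ?_
    (fun x _ => hf.differentiable (by simp) x) (fun x _ => hg.differentiable (by simp) x)
  · exact ((contDiff_dirDeriv hf v).continuous.mul hg.continuous).integrable_of_hasCompactSupport
      hs.mul_left
  · exact (hf.continuous.mul (contDiff_dirDeriv hg v).continuous).integrable_of_hasCompactSupport
      hg'.mul_left
  · exact (hf.continuous.mul hg.continuous).integrable_of_hasCompactSupport hs.mul_left

lemma integral_mul_dirDerivs {f g : E n → ℝ} (hf : ContDiff ℝ ∞ f) (hg : ContDiff ℝ ∞ g)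
    (hs : HasCompactSupport g) (l : List (E n)) :
    ∫ x, f x * dirDerivs l g x = (-1) ^ l.length * ∫ x, dirDerivs l f x * g x := by
  -- Integration by parts moves the outermost derivative of `g` first, where it becomes the
  -- innermost one on `f`; the induction therefore produces the reversed list.
  rw [dirDerivs_perm hf l.reverse_perm.symm]
  induction l generalizing f with
  | nil => simp
  | cons v l ih =>
    rw [dirDerivs_cons, integral_mul_dirDeriv hf (contDiff_dirDerivs hg l)
      (hasCompactSupport_dirDerivs hs l), ih (contDiff_dirDeriv hf v)]
    have : dirDerivs l.reverse (dirDeriv v f) = dirDerivs (v :: l).reverse f := by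
      simp [dirDerivs, List.foldr_append]
    rw [this, List.length_cons]
    ring

lemma integral_mul_negLaplacian {f g : E n → ℝ} (hf : ContDiff ℝ ∞ f) (hg : ContDiff ℝ ∞ g)
    (hs : HasCompactSupport g) :
    ∫ x, f x * negLaplacian g x = ∫ x, negLaplacian f x * g x := by
  rw [negLaplacian_eq_sum hf, negLaplacian_eq_sum hg]
  simp_rw [mul_neg, neg_mul, Finset.mul_sum, Finset.sum_mul]
  rw [integral_neg, integral_neg, integral_finsetSum, integral_finsetSum]
  · congr 1
    refine Finset.sum_congr rfl fun i _ => ?_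
    have hs' : HasCompactSupport (dirDeriv (stdVec i) g) := hs.fderiv_apply ℝ _
    rw [integral_mul_dirDeriv hf (contDiff_dirDeriv hg _) hs',
      integral_mul_dirDeriv (contDiff_dirDeriv hf _) hg hs, neg_neg]
  · intro i _
    exact ((contDiff_dirDeriv (contDiff_dirDeriv hf _) _).continuous.mul
      hg.continuous).integrable_of_hasCompactSupport hs.mul_left
  · intro i _
    have hs' := hasCompactSupport_dirDerivs hs [stdVec i, stdVec i]
    exact (hf.continuous.mul (contDiff_dirDeriv (contDiff_dirDeriv hg _) _).continuous
      ).integrable_of_hasCompactSupport hs'.mul_left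

lemma integral_mul_negLaplacian_iterate {f g : E n → ℝ} (hf : ContDiff ℝ ∞ f)
    (hg : ContDiff ℝ ∞ g) (hs : HasCompactSupport g) (k : ℕ) :
    ∫ x, f x * negLaplacian^[k] g x = ∫ x, negLaplacian^[k] f x * g x := by
  induction k generalizing g with
  | zero => rfl
  | succ k ih =>
    rw [Function.iterate_succ_apply, ih (contDiff_negLaplacian hg)
      (hasCompactSupport_negLaplacian hs),
      integral_mul_negLaplacian (contDiff_negLaplacian_iterate hf k) hg hs,
      Function.iterate_succ_apply']

end DirectionalDerivatives

/-! ### The kernel `|z|^(-c)`: its derivatives, and truncations that are smooth at the origin. -/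

section NormPowers

variable {n : ℕ}

/-! ### Powers of the norm -/

lemma hasFDerivAt_norm_rpow_neg (c : ℝ) {z : E n} (hz : z ≠ 0) :
    HasFDerivAt (fun y : E n => ‖y‖ ^ (-c)) ((-c * ‖z‖ ^ (-(c + 2))) • innerSL ℝ z) z := by
  have h0 : 0 < ‖z‖ := norm_pos_iff.2 hz
  have h1 : (fun y : E n => ‖y‖ ^ (-c)) = fun y => (‖y‖ ^ 2) ^ (-c / 2) := by
    ext y
    rw [← Real.rpow_natCast, ← Real.rpow_mul (norm_nonneg _)]
    congr 1
    push_cast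
    ring
  rw [h1]
  have h2 := (hasStrictFDerivAt_norm_sq z).hasFDerivAt.rpow_const (p := -c / 2)
    (Or.inl (by positivity))
  refine h2.congr_fderiv ?_
  rw [← Real.rpow_natCast, ← Real.rpow_mul (norm_nonneg _),
    show ((2 : ℕ) : ℝ) * (-c / 2 - 1) = -(c + 2) by push_cast; ring]
  ext w
  simp only [_root_.smul_apply, nsmul_eq_mul, smul_eq_mul]
  push_cast
  ring

lemma dirDeriv_norm_rpow (c : ℝ) (v : E n) {z : E n} (hz : z ≠ 0) :
    dirDeriv v (fun y : E n => ‖y‖ ^ (-c)) z = -c * (‖z‖ ^ (-(c + 2)) * inner ℝ z v) := by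
  rw [dirDeriv, (hasFDerivAt_norm_rpow_neg c hz).fderiv]
  simp
  ring

lemma dirDeriv_dirDeriv_norm_rpow (c : ℝ) (v w : E n) {z : E n} (hz : z ≠ 0) :
    dirDeriv w (dirDeriv v fun y : E n => ‖y‖ ^ (-c)) z =
      -c * ‖z‖ ^ (-(c + 2)) * inner ℝ w v
        + c * (c + 2) * ‖z‖ ^ (-(c + 4)) * (inner ℝ z v * inner ℝ z w) := by
  have h : dirDeriv v (fun y : E n => ‖y‖ ^ (-c)) =ᶠ[𝓝 z]
      fun y => -c * (‖y‖ ^ (-(c + 2)) * inner ℝ y v) := by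
    filter_upwards [isOpen_ne.mem_nhds hz] with y hy
    exact dirDeriv_norm_rpow c v hy
  have h2 : HasFDerivAt (fun y : E n => (inner ℝ y v : ℝ)) (innerSL ℝ v) z := by
    simp_rw [real_inner_comm v]
    exact (innerSL ℝ v).hasFDerivAt
  rw [dirDeriv, h.fderiv_eq,
    (((hasFDerivAt_norm_rpow_neg (c + 2) hz).fun_mul h2).const_mul (-c)).fderiv]
  simp only [_root_.smul_apply, _root_.add_apply, innerSL_apply_apply,
    smul_eq_mul]
  rw [show c + 2 + 2 = c + 4 by ring, real_inner_comm v w]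
  ring

lemma sum_inner_stdVec_sq (z : E n) : ∑ i, inner ℝ z (stdVec i) * inner ℝ z (stdVec i) = ‖z‖ ^ 2 := by
  rw [EuclideanSpace.real_norm_sq_eq]
  refine Finset.sum_congr rfl fun i _ => ?_
  simp [EuclideanSpace.inner_single_right, sq]

lemma sum_dirDeriv_dirDeriv_norm_rpow (c : ℝ) {z : E n} (hz : z ≠ 0) :
    ∑ i, dirDeriv (stdVec i) (dirDeriv (stdVec i) fun y : E n => ‖y‖ ^ (-c)) z =
      -(c * (n - c - 2)) * ‖z‖ ^ (-(c + 2)) := by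
  simp_rw [dirDeriv_dirDeriv_norm_rpow c _ _ hz]
  rw [Finset.sum_add_distrib, ← Finset.mul_sum, ← Finset.mul_sum, sum_inner_stdVec_sq]
  have h0 : 0 < ‖z‖ := norm_pos_iff.2 hz
  have : ‖z‖ ^ (-(c + 2)) = ‖z‖ ^ (-(c + 4)) * ‖z‖ ^ 2 := by
    rw [← Real.rpow_natCast, ← Real.rpow_add h0]
    congr 1
    push_cast
    ring
  rw [this]
  simp
  ring

/-- The power is singular at 0, so it is represented by a globally smooth `f` with the same germ at
`z`. A conclusion about germs can be iterated. -/
lemma negLaplacian_eventuallyEq_norm_rpow {f : E n → ℝ} (hf : ContDiff ℝ ∞ f) {A c : ℝ} {z : E n}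
    (hz : z ≠ 0) (h : f =ᶠ[𝓝 z] fun y => A * ‖y‖ ^ (-c)) :
    negLaplacian f =ᶠ[𝓝 z] fun y => A * (c * (n - c - 2)) * ‖y‖ ^ (-(c + 2)) := by
  filter_upwards [isOpen_ne.mem_nhds hz, eventually_eventually_nhds.2 h] with y hy hfy
  rw [negLaplacian_eq_sum hf]
  have key (i : Fin n) : dirDeriv (stdVec i) (dirDeriv (stdVec i) f) y =
      A * dirDeriv (stdVec i) (dirDeriv (stdVec i) fun y : E n => ‖y‖ ^ (-c)) y := by
    have h1 : dirDeriv (stdVec i) f =ᶠ[𝓝 y]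
        fun y => A * dirDeriv (stdVec i) (fun y : E n => ‖y‖ ^ (-c)) y := by
      filter_upwards [isOpen_ne.mem_nhds hy, dirDeriv_eventuallyEq hfy (stdVec i)] with x hx hfx
      rw [hfx, dirDeriv, dirDeriv,
        fderiv_const_mul (hasFDerivAt_norm_rpow_neg c hx).differentiableAt]
      simp
    have h2 : DifferentiableAt ℝ (dirDeriv (stdVec i) (fun y : E n => ‖y‖ ^ (-c))) y := by
      have h3 : dirDeriv (stdVec i) (fun y : E n => ‖y‖ ^ (-c)) =ᶠ[𝓝 y]
          fun y => -c * (‖y‖ ^ (-(c + 2)) * inner ℝ y (stdVec i)) := by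
        filter_upwards [isOpen_ne.mem_nhds hy] with x hx
        exact dirDeriv_norm_rpow c _ hx
      refine DifferentiableAt.congr_of_eventuallyEq ?_ h3
      exact ((hasFDerivAt_norm_rpow_neg (c + 2) hy).differentiableAt.fun_mul
        (differentiableAt_id.inner ℝ (differentiableAt_const _))).const_mul _
    rw [dirDeriv, h1.fderiv_eq, fderiv_const_mul h2]
    simp [dirDeriv]
  simp_rw [key]
  rw [← Finset.mul_sum, sum_dirDeriv_dirDeriv_norm_rpow c hy]
  ring

lemma negLaplacian_iterate_eventuallyEq_norm_rpow {f : E n → ℝ} (hf : ContDiff ℝ ∞ f) {c : ℝ}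
    {z : E n} (hz : z ≠ 0) (h : f =ᶠ[𝓝 z] fun y => ‖y‖ ^ (-c)) (k : ℕ) :
    negLaplacian^[k] f =ᶠ[𝓝 z] fun y =>
      (∏ j ∈ Finset.range k, ((c + 2 * j) * (n - (c + 2 * j) - 2))) * ‖y‖ ^ (-(c + 2 * k)) := by
  induction k with
  | zero => simpa using h
  | succ k ih =>
    rw [Function.iterate_succ_apply', Finset.prod_range_succ]
    convert negLaplacian_eventuallyEq_norm_rpow (contDiff_negLaplacian_iterate hf k) hz ih using 5
    push_cast
    ring

/-- For `c = n - 2m` the factor `j = m - 1` of the product is `n - (n - 2) - 2 = 0`: this power is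
polyharmonic away from the origin. -/
lemma negLaplacian_iterate_eventuallyEq_zero {f : E n → ℝ} (hf : ContDiff ℝ ∞ f) {m : ℕ}
    (hm : 0 < m) {z : E n} (hz : z ≠ 0) (h : f =ᶠ[𝓝 z] fun y => ‖y‖ ^ (-((n : ℝ) - 2 * m))) :
    negLaplacian^[m] f =ᶠ[𝓝 z] fun _ => 0 := by
  filter_upwards [negLaplacian_iterate_eventuallyEq_norm_rpow hf hz h m] with y hy
  rw [hy, Finset.prod_eq_zero (i := m - 1) (by simpa using hm), zero_mul]
  rw [Nat.cast_sub (by lia)]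
  push_cast
  ring

/-! ### Smooth truncations of powers of the norm -/

/-- The function `‖z‖⁻ᶜ`, smoothly truncated in the unit ball. -/
def truncPow (c : ℝ) (z : E n) : ℝ := Real.smoothTransition (2 * ‖z‖ ^ 2 - 1) * ‖z‖ ^ (-c)

/-- The rescaling `r⁻ᶜ f(z / r)`. -/
def rescale (c r : ℝ) (f : E n → ℝ) (z : E n) : ℝ := r ^ (-c) * f (r⁻¹ • z)

lemma contDiff_truncPow (c : ℝ) : ContDiff ℝ ∞ (truncPow c : E n → ℝ) := by
  rw [contDiff_iff_contDiffAt]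
  intro z
  by_cases hz : z = 0
  · have : (truncPow c : E n → ℝ) =ᶠ[𝓝 z] fun _ => 0 := by
      filter_upwards [Metric.ball_mem_nhds z (by norm_num : (0 : ℝ) < 1 / 2)] with y hy
      rw [hz, mem_ball_zero_iff] at hy
      rw [truncPow, Real.smoothTransition.zero_of_nonpos (by nlinarith [norm_nonneg y]), zero_mul]
    exact contDiffAt_const.congr_of_eventuallyEq this
  · have h1 : ContDiffAt ℝ ∞ (fun y : E n => Real.smoothTransition (2 * ‖y‖ ^ 2 - 1)) z :=
      Real.smoothTransition.contDiff.contDiffAt.comp z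
        ((contDiffAt_const.mul (contDiff_norm_sq ℝ).contDiffAt).sub contDiffAt_const)
    exact h1.mul ((contDiffAt_norm ℝ hz).rpow_const_of_ne (norm_ne_zero_iff.2 hz))

lemma contDiff_rescale {f : E n → ℝ} (hf : ContDiff ℝ ∞ f) (c r : ℝ) :
    ContDiff ℝ ∞ (rescale c r f) := by
  unfold rescale; fun_prop

lemma dirDerivs_rescale {f : E n → ℝ} (hf : ContDiff ℝ ∞ f) (c : ℝ) {r : ℝ} (hr : 0 < r)
    (l : List (E n)) : dirDerivs l (rescale c r f) = rescale (c + l.length) r (dirDerivs l f) := by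
  unfold rescale
  rw [dirDerivs_const_mul (by fun_prop), dirDerivs_comp_smul hf]
  ext z
  rw [← mul_assoc, neg_add, Real.rpow_add hr, Real.rpow_neg hr.le _, Real.rpow_neg hr.le _,
    Real.rpow_natCast, inv_pow]

lemma negLaplacian_iterate_rescale {f : E n → ℝ} (hf : ContDiff ℝ ∞ f) (c : ℝ) {r : ℝ} (hr : 0 < r)
    (k : ℕ) : negLaplacian^[k] (rescale c r f) = rescale (c + 2 * k) r (negLaplacian^[k] f) := by
  unfold rescale
  rw [negLaplacian_iterate_const_mul (by fun_prop), negLaplacian_iterate_comp_smul hf]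
  ext z
  have : r ^ (-(2 * (k : ℝ))) = r⁻¹ ^ (2 * k) := by
    rw [Real.rpow_neg hr.le, inv_pow, ← Real.rpow_natCast]
    push_cast
    rfl
  rw [← mul_assoc, neg_add, Real.rpow_add hr, this]

lemma rescale_truncPow (c : ℝ) {r : ℝ} (hr : 0 < r) (z : E n) :
    rescale c r (truncPow c) z = Real.smoothTransition (2 * (‖z‖ / r) ^ 2 - 1) * ‖z‖ ^ (-c) := by
  rw [rescale, truncPow, norm_smul, norm_inv, Real.norm_of_nonneg hr.le, inv_mul_eq_div,
    Real.div_rpow (norm_nonneg _) hr.le]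
  have := (Real.rpow_pos_of_pos hr (-c)).ne'
  field_simp

lemma rescale_truncPow_eq (c : ℝ) {r : ℝ} (hr : 0 < r) {z : E n} (hz : r ≤ ‖z‖) :
    rescale c r (truncPow c) z = ‖z‖ ^ (-c) := by
  rw [rescale_truncPow c hr, Real.smoothTransition.one_of_one_le, one_mul]
  nlinarith [(one_le_div hr).2 hz]

lemma rescale_truncPow_eq_zero (c : ℝ) {r : ℝ} (hr : 0 < r) {z : E n} (hz : ‖z‖ ≤ r / 2) :
    rescale c r (truncPow c) z = 0 := by
  rw [rescale_truncPow c hr, Real.smoothTransition.zero_of_nonpos, zero_mul]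
  have h1 : ‖z‖ / r ≤ 1 / 2 := by rw [div_le_iff₀ hr]; linarith
  nlinarith [div_nonneg (norm_nonneg z) hr.le]

lemma rescale_truncPow_eventuallyEq (c : ℝ) {r : ℝ} (hr : 0 < r) {z : E n} (hz : r < ‖z‖) :
    rescale c r (truncPow c) =ᶠ[𝓝 z] fun y => ‖y‖ ^ (-c) := by
  filter_upwards [continuousAt_id.norm.eventually (lt_mem_nhds hz)] with y hy
  exact rescale_truncPow_eq c hr (le_of_lt hy)

lemma rescale_truncPow_eventuallyEq_zero (c : ℝ) {r : ℝ} (hr : 0 < r) {z : E n} (hz : ‖z‖ < r / 2) :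
    rescale c r (truncPow c) =ᶠ[𝓝 z] fun _ => 0 := by
  filter_upwards [continuousAt_id.norm.eventually (gt_mem_nhds hz)] with y hy
  exact rescale_truncPow_eq_zero c hr (le_of_lt hy)

/-- This monotonicity in the scale makes `annularPow` nonnegative, as Fatou's lemma will require. -/
lemma rescale_truncPow_anti (c : ℝ) {r R : ℝ} (hr : 0 < r) (h : r ≤ R) (z : E n) :
    rescale c R (truncPow c) z ≤ rescale c r (truncPow c) z := by
  rw [rescale_truncPow c hr, rescale_truncPow c (hr.trans_le h)]
  have hR := hr.trans_le h
  gcongr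
  exact Real.smoothTransition.monotone (by gcongr)

/-- Scale-invariant derivative bounds for the truncated powers. -/
lemma exists_abs_dirDerivs_rescale_truncPow_le {c : ℝ} (hc : 0 ≤ c) (l : List (E n)) :
    ∃ B : ℝ, ∀ r : ℝ, 0 < r → ∀ z : E n, z ≠ 0 →
      |dirDerivs l (rescale c r (truncPow c)) z| ≤ B * ‖z‖ ^ (-(c + l.length)) := by
  have hsm := contDiff_truncPow (n := n) c
  obtain ⟨B, hB⟩ := (isCompact_closedBall (0 : E n) 2).exists_bound_of_continuousOn
    (contDiff_dirDerivs hsm l).continuous.continuousOn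
  have hB0 : 0 ≤ B := (norm_nonneg _).trans (hB 0 (by simp))
  set d : ℝ := c + l.length with hd
  have hd0 : 0 ≤ d := by positivity
  have key (z : E n) (hz : z ≠ 0) :
      |dirDerivs l (truncPow c) z| ≤ B * (‖z‖ / 2) ^ (-d) := by
    have hz0 : 0 < ‖z‖ := norm_pos_iff.2 hz
    by_cases h2 : ‖z‖ ≤ 2
    · refine (hB z (by simpa using h2)).trans (le_mul_of_one_le_right hB0 ?_)
      exact Real.one_le_rpow_of_pos_of_le_one_of_nonpos (by positivity) (by linarith) (by linarith)
    -- Far out, `truncPow c` coincides near `z` with its own rescaling by `‖z‖ / 2`. The derivative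
    -- at `z` is thus a scaled derivative at a point of norm 2, where `B` applies.
    · have h1 : (truncPow c : E n → ℝ) =ᶠ[𝓝 z] rescale c (‖z‖ / 2) (truncPow c) := by
        have e1 := rescale_truncPow_eventuallyEq c one_pos (show 1 < ‖z‖ by linarith)
        have e2 := rescale_truncPow_eventuallyEq c (half_pos hz0) (half_lt_self hz0)
        filter_upwards [e1, e2] with y h1 h2
        rw [h2, ← h1]
        simp [rescale]
      rw [(dirDerivs_eventuallyEq h1 l).eq_of_nhds, dirDerivs_rescale hsm c (half_pos hz0), rescale,
        abs_mul, abs_of_pos (Real.rpow_pos_of_pos (half_pos hz0) _), mul_comm]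
      gcongr
      refine hB _ ?_
      rw [mem_closedBall_zero_iff, norm_smul, norm_inv, Real.norm_of_nonneg (half_pos hz0).le]
      exact le_of_eq (by field_simp)
  refine ⟨B * 2 ^ d, fun r hr z hz => ?_⟩
  have hz0 : 0 < ‖z‖ := norm_pos_iff.2 hz
  rw [dirDerivs_rescale hsm c hr, rescale, abs_mul, abs_of_pos (Real.rpow_pos_of_pos hr _), ← hd]
  refine (mul_le_mul_of_nonneg_left (key (r⁻¹ • z) (smul_ne_zero (inv_ne_zero hr.ne') hz))
    (by positivity)).trans_eq ?_
  rw [norm_smul, norm_inv, Real.norm_of_nonneg hr.le, inv_mul_eq_div, div_div,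
    Real.div_rpow hz0.le (by positivity), Real.mul_rpow hr.le (by norm_num),
    Real.rpow_neg (by norm_num : (0 : ℝ) ≤ 2)]
  have := (Real.rpow_pos_of_pos hr (-d)).ne'
  field_simp

/-- Near a nonzero point, a power of the norm agrees with a smooth function. -/
lemma exists_contDiff_eventuallyEq_norm_rpow (c : ℝ) {z : E n} (hz : z ≠ 0) :
    ∃ f : E n → ℝ, ContDiff ℝ ∞ f ∧ f =ᶠ[𝓝 z] fun y => ‖y‖ ^ (-c) :=
  ⟨_, contDiff_rescale (contDiff_truncPow c) c (‖z‖ / 2), rescale_truncPow_eventuallyEq c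
    (half_pos (norm_pos_iff.2 hz)) (half_lt_self (norm_pos_iff.2 hz))⟩

/-- Third and fourth derivatives of the kernel are needed only with a pair of indices traced, so
they reduce to lower derivatives of another power. -/
lemma sum_dirDerivs_norm_rpow_eq_negLaplacian (c : ℝ) (l : List (E n)) {z : E n} (hz : z ≠ 0) :
    ∑ i, dirDerivs (l ++ [stdVec i, stdVec i]) (fun y : E n => ‖y‖ ^ (-c)) z =
      dirDerivs l (fun y : E n => -(c * (n - c - 2)) * ‖y‖ ^ (-(c + 2))) z := by
  obtain ⟨f, hf, hfz⟩ := exists_contDiff_eventuallyEq_norm_rpow c hz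
  have h1 : negLaplacian f =ᶠ[𝓝 z] fun y => 1 * (c * (n - c - 2)) * ‖y‖ ^ (-(c + 2)) :=
    negLaplacian_eventuallyEq_norm_rpow hf hz (by simpa using hfz)
  have hsum : dirDerivs l (fun y => ∑ i, dirDerivs [stdVec i, stdVec i] f y) =
      fun y => ∑ i, dirDerivs (l ++ [stdVec i, stdVec i]) f y := by
    induction l with
    | nil => rfl
    | cons v l ih =>
      rw [dirDerivs_cons, ih, dirDeriv_sum _ fun i _ => contDiff_dirDerivs hf _]
      rfl
  have h2 : (fun y => ∑ i, dirDerivs [stdVec i, stdVec i] f y) =ᶠ[𝓝 z]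
      fun y : E n => -(c * (n - c - 2)) * ‖y‖ ^ (-(c + 2)) := by
    filter_upwards [h1] with y hy
    rw [negLaplacian_eq_sum hf, one_mul] at hy
    simp only [dirDerivs_cons, dirDerivs_nil]
    linarith
  rw [← (dirDerivs_eventuallyEq h2 l).eq_of_nhds, hsum]
  exact Finset.sum_congr rfl fun i _ => ((dirDerivs_eventuallyEq hfz _).eq_of_nhds).symm

end NormPowers

/-! ### The test-function method: averages of `u` over large balls tend to 0. -/

section Averages

open Polynomial

variable {n : ℕ}

/-! ### A test function whose Laplacians are controlled by its powers -/

/-- The functions `p((1 - |z|²)⁻¹) exp(-(1 - |z|²)⁻¹)` on the unit ball, extended by zero. -/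
def bumpPoly (p : ℝ[X]) (z : E n) : ℝ :=
  p.eval (1 - ‖z‖ ^ 2)⁻¹ * expNegInvGlue (1 - ‖z‖ ^ 2)

lemma contDiff_bumpPoly (p : ℝ[X]) : ContDiff ℝ ∞ (bumpPoly p : E n → ℝ) := by
  have h : ContDiff ℝ ∞ fun z : E n => 1 - ‖z‖ ^ 2 := contDiff_const.sub (contDiff_norm_sq ℝ)
  exact (expNegInvGlue.contDiff_polynomial_eval_inv_mul p).comp h

lemma dirDeriv_bumpPoly (p : ℝ[X]) (v z : E n) :
    dirDeriv v (bumpPoly p) z =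
      -2 * (bumpPoly (X ^ 2 * (p - derivative p)) z * inner ℝ z v) := by
  have h1 : HasFDerivAt (fun z : E n => 1 - ‖z‖ ^ 2) (-(2 • innerSL ℝ z)) z := by
    simpa using (hasStrictFDerivAt_norm_sq z).hasFDerivAt.const_sub 1
  have h2 := (expNegInvGlue.hasDerivAt_polynomial_eval_inv_mul p (1 - ‖z‖ ^ 2)).comp_hasFDerivAt z h1
  have h3 : HasFDerivAt (bumpPoly p) _ z := h2
  rw [dirDeriv, h3.fderiv]
  simp [bumpPoly]
  ring

lemma dirDeriv_dirDeriv_bumpPoly (p : ℝ[X]) (v z : E n) :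
    dirDeriv v (dirDeriv v (bumpPoly p)) z =
      4 * bumpPoly (X ^ 2 * ((X ^ 2 * (p - derivative p)) - derivative (X ^ 2 * (p - derivative p)))) z
        * (inner ℝ z v * inner ℝ z v)
      - 2 * bumpPoly (X ^ 2 * (p - derivative p)) z * ‖v‖ ^ 2 := by
  have h := funext (dirDeriv_bumpPoly p v)
  set q := X ^ 2 * (p - derivative p)
  have hi : ContDiff ℝ ∞ fun z : E n => (inner ℝ z v : ℝ) := contDiff_id.inner ℝ contDiff_const
  have h2 : dirDeriv v (fun z : E n => (inner ℝ z v : ℝ)) z = ‖v‖ ^ 2 := by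
    have : HasFDerivAt (fun y : E n => (inner ℝ y v : ℝ)) (innerSL ℝ v) z := by
      simp_rw [real_inner_comm v]
      exact (innerSL ℝ v).hasFDerivAt
    rw [dirDeriv, this.fderiv]
    simp
  rw [h, dirDeriv_const_mul ((contDiff_bumpPoly q).mul hi), dirDeriv_mul (contDiff_bumpPoly q) hi]
  simp only [h2, dirDeriv_bumpPoly q v z]
  ring

/-- The family is closed under `-Δ`: with `t = 1 - |z|²`, each derivative of `p(1/t) exp(-1/t)` in
`t` gives `X² (p - p')`, and the factor `|z|² = 1 - t` is again expressible in `1/t`. -/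
lemma exists_negLaplacian_bumpPoly (n : ℕ) (p : ℝ[X]) :
    ∃ q : ℝ[X], negLaplacian (bumpPoly p : E n → ℝ) = bumpPoly q := by
  set q := X ^ 2 * (p - derivative p)
  -- Since `|z|² = 1 - 1/X` at `X = 1/t`, the factor `X² |z|²` becomes `X² - X`.
  refine ⟨-(4 * (X ^ 2 * (q - derivative q)) - 4 * (X * (q - derivative q)) - C (2 * (n : ℝ)) * q), ?_⟩
  rw [negLaplacian_eq_sum (contDiff_bumpPoly p)]
  ext z
  simp_rw [dirDeriv_dirDeriv_bumpPoly]
  rw [Finset.sum_sub_distrib, ← Finset.mul_sum, ← Finset.mul_sum, sum_inner_stdVec_sq]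
  have h : ∑ i : Fin n, ‖(stdVec i : E n)‖ ^ 2 = n := by simp
  rw [h]
  change -(4 * bumpPoly (X ^ 2 * (q - derivative q)) z * ‖z‖ ^ 2 - 2 * bumpPoly q z * n) = _
  simp only [bumpPoly, eval_neg, eval_sub, eval_mul, eval_pow, eval_X, eval_C, eval_ofNat]
  by_cases hz : 1 - ‖z‖ ^ 2 = 0
  · simp [hz]
  · have : ‖z‖ ^ 2 = 1 - (1 - ‖z‖ ^ 2) := by ring
    rw [this]
    generalize 1 - ‖z‖ ^ 2 = t at *
    field_simp
    ring

lemma exists_negLaplacian_iterate_bumpPoly (n m : ℕ) (p : ℝ[X]) :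
    ∃ q : ℝ[X], negLaplacian^[m] (bumpPoly p : E n → ℝ) = bumpPoly q := by
  induction m with
  | zero => exact ⟨p, rfl⟩
  | succ m ih =>
    obtain ⟨q, hq⟩ := ih
    rw [Function.iterate_succ_apply', hq]
    exact exists_negLaplacian_bumpPoly n q

/-- Split `exp(-1/t) = exp(-(1-θ)/t) exp(-θ/t)`. The first factor absorbs the polynomial, and the
product is bounded by continuity on a compact interval after the substitution `t ↦ t/(1-θ)`. -/
lemma exists_abs_bumpPoly_le (n : ℕ) (p : ℝ[X]) {θ : ℝ} (h0 : 0 < θ) (h1 : θ < 1) :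
    ∃ C : ℝ, ∀ z : E n, |bumpPoly p z| ≤ C * bumpPoly 1 z ^ θ := by
  have hd : 0 < 1 - θ := by linarith
  set q : ℝ[X] := p.comp (C (1 - θ)⁻¹ * X) with hq
  obtain ⟨B, hB⟩ := (isCompact_Icc (a := (0 : ℝ)) (b := (1 - θ)⁻¹)).exists_bound_of_continuousOn
    (expNegInvGlue.continuous_polynomial_eval_inv_mul q).continuousOn
  refine ⟨B, fun z => ?_⟩
  simp only [bumpPoly, eval_one, one_mul]
  have ht1 : 1 - ‖z‖ ^ 2 ≤ 1 := by nlinarith [sq_nonneg ‖z‖]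
  generalize 1 - ‖z‖ ^ 2 = t at *
  rcases le_or_gt t 0 with ht | ht
  · rw [expNegInvGlue.zero_of_nonpos ht]
    simp [Real.zero_rpow h0.ne']
  · have hy : t * (1 - θ)⁻¹ ∈ Set.Icc (0 : ℝ) (1 - θ)⁻¹ :=
      ⟨by positivity, mul_le_of_le_one_left (by positivity) ht1⟩
    have hty : 0 < t * (1 - θ)⁻¹ := by positivity
    have key : p.eval t⁻¹ * expNegInvGlue t =
        (q.eval (t * (1 - θ)⁻¹)⁻¹ * expNegInvGlue (t * (1 - θ)⁻¹)) * expNegInvGlue t ^ θ := by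
      rw [hq, eval_comp, eval_mul, eval_C, eval_X, expNegInvGlue, if_neg ht.not_ge, expNegInvGlue,
        if_neg hty.not_ge, ← Real.exp_mul, mul_assoc, ← Real.exp_add]
      congr 2
      · field_simp
      · field_simp
        ring
    rw [key, abs_mul, abs_of_nonneg (Real.rpow_nonneg (expNegInvGlue.nonneg t) θ)]
    exact mul_le_mul_of_nonneg_right (hB _ hy) (Real.rpow_nonneg (expNegInvGlue.nonneg t) θ)

lemma exists_testFunction (n m : ℕ) {θ : ℝ} (h0 : 0 < θ) (h1 : θ < 1) :
    ∃ φ : E n → ℝ, ContDiff ℝ ∞ φ ∧ (∀ z, 0 ≤ φ z) ∧ (∀ z, 1 ≤ ‖z‖ → φ z = 0) ∧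
      (∃ C, 0 < C ∧ ∀ z, |negLaplacian^[m] φ z| ≤ C * φ z ^ θ) ∧
      ∃ c, 0 < c ∧ ∀ z, ‖z‖ ≤ 1 / 2 → c ≤ φ z ^ θ := by
  obtain ⟨q, hq⟩ := exists_negLaplacian_iterate_bumpPoly n m 1
  obtain ⟨C, hC⟩ := exists_abs_bumpPoly_le n q h0 h1
  have hpos (z : E n) : 0 ≤ bumpPoly 1 z := by
    simpa [bumpPoly] using expNegInvGlue.nonneg _
  refine ⟨bumpPoly 1, contDiff_bumpPoly 1, hpos, fun z hz => ?_,
    ⟨max C 1, by positivity, fun z => ?_⟩,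
    expNegInvGlue (1 / 2) ^ θ, Real.rpow_pos_of_pos (expNegInvGlue.pos_of_pos (by norm_num)) _,
    fun z hz => ?_⟩
  · simp only [bumpPoly, eval_one, one_mul]
    exact expNegInvGlue.zero_of_nonpos (by nlinarith)
  · rw [hq]
    exact (hC z).trans (mul_le_mul_of_nonneg_right (le_max_left _ _)
      (Real.rpow_nonneg (hpos z) θ))
  · simp only [bumpPoly, eval_one, one_mul]
    refine Real.rpow_le_rpow (expNegInvGlue.nonneg _) (expNegInvGlue.monotone ?_) h0.le
    nlinarith [norm_nonneg z]

/-! ### Decay of the averages of a solution -/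

/-- This stands in for Hölder's inequality: values below `M` are counted by volume, values above `M`
by the `p`-th power. -/
lemma le_add_rpow_mul {p M t : ℝ} (hp : 1 ≤ p) (hM : 0 < M) (ht : 0 ≤ t) :
    t ≤ M + M ^ (1 - p) * t ^ p := by
  rcases le_or_gt t M with h | h
  · have : 0 ≤ M ^ (1 - p) * t ^ p := by positivity
    linarith
  · have h0 : 0 < t := hM.trans h
    have : t ^ (1 - p) ≤ M ^ (1 - p) := Real.rpow_le_rpow_of_nonpos hM h.le (by linarith)
    calc t = t ^ (1 - p) * t ^ p := by rw [← Real.rpow_add h0]; simp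
      _ ≤ M ^ (1 - p) * t ^ p := by gcongr
      _ ≤ _ := by linarith

/-- Let `v = u φ_R^(1/p)`. Pairing the equation with `φ_R` gives `c R^s ∫ v^p ≤ C R^(-2m) ∫ v`,
because `|(-Δ)^m φ| ≤ C φ^(1/p)`. Inserted in `v ≤ M + M^(1-p) v^p`, the last term has a coefficient
of order `R^(-(2m+s))`; it is absorbed for large `R`, which leaves a bound by the arbitrarily small
`M` times the volume. -/
lemma integral_le_of_superlinear {u : E n → ℝ} (hu : ContDiff ℝ ∞ u) (hpos : ∀ x, 0 < u x)
    {m : ℕ} {p s c : ℝ} (hp : 1 < p) (hs : -(2 * (m : ℝ)) < s) (hc : 0 < c)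
    (hf : ∀ᶠ R : ℝ in atTop, ∀ x, ‖x‖ ≤ R → c * R ^ s * u x ^ p ≤ negLaplacian^[m] u x)
    {ε : ℝ} (hε : 0 < ε) :
    ∀ᶠ R : ℝ in atTop, ∫ x in Metric.ball 0 R, u x ≤ ε * R ^ n := by
  have hp0 : 0 < p := by linarith
  obtain ⟨φ, hφ, hφ0, hφ1, ⟨C, hC0, hC⟩, b, hb0, hb⟩ :=
    exists_testFunction n m (θ := p⁻¹) (by positivity) (inv_lt_one_of_one_lt₀ hp)
  set V : ℝ := volume.real (Metric.closedBall (0 : E n) 1) with hV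
  have hV0 : 0 ≤ V := measureReal_nonneg
  -- Chosen so that `2 M (V + 1) R^n = b ε (R/2)^n`; the 1 spares a proof that `V > 0`.
  set M : ℝ := ε * b / (2 * (V + 1) * 2 ^ n) with hM
  have hM0 : 0 < M := by positivity
  have hlim : Tendsto (fun R : ℝ => M ^ (1 - p) * (C / c) * R ^ (-(2 * (m : ℝ) + s))) atTop (𝓝 0) := by
    simpa using (tendsto_rpow_neg_atTop (show 0 < 2 * (m : ℝ) + s by linarith)).const_mul
      (M ^ (1 - p) * (C / c))
  have main : ∀ᶠ R : ℝ in atTop, ∫ x in Metric.ball 0 (R / 2), u x ≤ ε * (R / 2) ^ n := by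
    filter_upwards [hf, hlim.eventually (gt_mem_nhds (by norm_num : (0 : ℝ) < 1 / 2)),
      eventually_gt_atTop 0] with R hfR hR hR0
    set φR : E n → ℝ := fun x => φ (R⁻¹ • x) with hφR
    have hnR (x : E n) : ‖R⁻¹ • x‖ = ‖x‖ / R := by
      rw [norm_smul, norm_inv, Real.norm_of_nonneg hR0.le, inv_mul_eq_div]
    have hφRs : ContDiff ℝ ∞ φR := by fun_prop
    have hφR1 (x : E n) (hx : R ≤ ‖x‖) : φR x = 0 :=
      hφ1 _ (by rw [hnR]; exact (one_le_div hR0).2 hx)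
    have hsupp {g : E n → ℝ} (hg : ∀ x, R ≤ ‖x‖ → g x = 0) : HasCompactSupport g := by
      refine HasCompactSupport.of_support_subset_isCompact (isCompact_closedBall (0 : E n) R)
        fun x hx => ?_
      rw [mem_closedBall_zero_iff]
      by_contra h
      exact hx (hg x (not_le.1 h).le)
    set v : E n → ℝ := fun x => u x * φR x ^ p⁻¹ with hv
    have hvc : Continuous v :=
      hu.continuous.mul (hφRs.continuous.rpow_const fun _ => Or.inr (by positivity))
    have hv0 (x) : 0 ≤ v x := mul_nonneg (hpos x).le (Real.rpow_nonneg (hφ0 _) _)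
    have hvR (x) (hx : R ≤ ‖x‖) : v x = 0 := by
      simp [hv, hφR1 x hx, Real.zero_rpow (inv_ne_zero hp0.ne')]
    have hvp (x) : v x ^ p = u x ^ p * φR x := by
      rw [hv, Real.mul_rpow (hpos x).le (Real.rpow_nonneg (hφ0 _) _),
        Real.rpow_inv_rpow (hφ0 _) hp0.ne']
    have hvpc : Continuous fun x => v x ^ p := hvc.rpow_const fun _ => Or.inr hp0.le
    have hvi : Integrable v := hvc.integrable_of_hasCompactSupport (hsupp hvR)
    have hvpi : Integrable fun x => v x ^ p :=
      hvpc.integrable_of_hasCompactSupport (hsupp fun x hx => by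
        rw [hvR x hx, Real.zero_rpow hp0.ne'])
    have hfi : Integrable fun x => negLaplacian^[m] u x * φR x :=
      ((contDiff_negLaplacian_iterate hu m).continuous.mul
        hφRs.continuous).integrable_of_hasCompactSupport (hsupp hφR1).mul_left
    have step1 : c * R ^ s * ∫ x, v x ^ p ≤ ∫ x, negLaplacian^[m] u x * φR x := by
      rw [← integral_const_mul]
      refine integral_mono (hvpi.const_mul _) hfi fun x => ?_
      rcases le_or_gt ‖x‖ R with h | h
      · simp only [hvp]
        rw [← mul_assoc]
        exact mul_le_mul_of_nonneg_right (hfR x h) (hφ0 _)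
      · simp [hvp, hφR1 x h.le]
    have step2 : ∫ x, negLaplacian^[m] u x * φR x ≤ C * R ^ (-(2 * (m : ℝ))) * ∫ x, v x := by
      rw [← integral_mul_negLaplacian_iterate hu hφRs (hsupp hφR1), ← integral_const_mul]
      refine integral_mono ?_ (hvi.const_mul _) fun x => ?_
      · exact (hu.continuous.mul (contDiff_negLaplacian_iterate hφRs m).continuous
          ).integrable_of_hasCompactSupport
            (hasCompactSupport_negLaplacian_iterate (hsupp hφR1) m).mul_left
      · have h1 : negLaplacian^[m] φR x = R ^ (-(2 * (m : ℝ))) * negLaplacian^[m] φ (R⁻¹ • x) := by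
          have : R ^ (-(2 * (m : ℝ))) = R⁻¹ ^ (2 * m) := by
            rw [Real.rpow_neg hR0.le, inv_pow, ← Real.rpow_natCast]
            push_cast
            rfl
          rw [hφR, negLaplacian_iterate_comp_smul hφ, this]
        have h2 := (le_abs_self _).trans (hC (R⁻¹ • x))
        have h3 : 0 ≤ u x * R ^ (-(2 * (m : ℝ))) := by have := hpos x; positivity
        calc u x * negLaplacian^[m] φR x
            = u x * R ^ (-(2 * (m : ℝ))) * negLaplacian^[m] φ (R⁻¹ • x) := by rw [h1]; ring
          _ ≤ u x * R ^ (-(2 * (m : ℝ))) * (C * φ (R⁻¹ • x) ^ p⁻¹) := by gcongr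
          _ = C * R ^ (-(2 * (m : ℝ))) * v x := by simp only [hv, hφR]; ring
    have step3 : ∫ x, v x ≤ M * (V * R ^ n) + M ^ (1 - p) * ∫ x, v x ^ p := by
      have hball : V * R ^ n = volume.real (Metric.closedBall (0 : E n) R) := by
        rw [hV, Measure.real, Measure.real, Measure.addHaar_closedBall' _ _ hR0.le]
        simp [hR0.le, mul_comm]
      have hi : Integrable ((Metric.closedBall (0 : E n) R).indicator fun _ => M) :=
        (integrable_indicator_iff measurableSet_closedBall).2
          (integrableOn_const (isCompact_closedBall _ _).measure_lt_top.ne)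
      have heq : M * (V * R ^ n) = ∫ x, (Metric.closedBall (0 : E n) R).indicator (fun _ => M) x := by
        rw [integral_indicator measurableSet_closedBall, setIntegral_const, hball, smul_eq_mul,
          mul_comm]
      rw [heq, ← integral_const_mul, ← integral_add hi (hvpi.const_mul _)]
      refine integral_mono hvi (hi.add (hvpi.const_mul _)) fun x => ?_
      by_cases hx : x ∈ Metric.closedBall (0 : E n) R
      · simp only [Set.indicator_of_mem hx]
        exact le_add_rpow_mul hp.le hM0 (hv0 x)
      · have : v x = 0 := hvR x (by simpa using (le_of_lt (by simpa using hx)))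
        simp [Set.indicator_of_notMem hx, this, Real.zero_rpow hp0.ne']
    have step4 : ∫ x, v x ≤ 2 * (M * (V * R ^ n)) := by
      have h1 : ∫ x, v x ^ p ≤ (C / c) * R ^ (-(2 * (m : ℝ) + s)) * ∫ x, v x := by
        have h2 := step1.trans step2
        have h3 : R ^ (-(2 * (m : ℝ) + s)) * R ^ s = R ^ (-(2 * (m : ℝ))) := by
          rw [← Real.rpow_add hR0]
          congr 1
          ring
        rw [← h3] at h2
        have h4 : 0 < R ^ s := Real.rpow_pos_of_pos hR0 s
        have h5 : 0 < c * R ^ s := by positivity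
        refine le_of_mul_le_mul_left (h2.trans_eq ?_) h5
        field_simp
      have h2 : M ^ (1 - p) * ∫ x, v x ^ p ≤ 1 / 2 * ∫ x, v x := by
        have h6 : 0 ≤ ∫ x, v x := integral_nonneg hv0
        calc M ^ (1 - p) * ∫ x, v x ^ p
            ≤ M ^ (1 - p) * ((C / c) * R ^ (-(2 * (m : ℝ) + s)) * ∫ x, v x) := by gcongr
          _ = (M ^ (1 - p) * (C / c) * R ^ (-(2 * (m : ℝ) + s))) * ∫ x, v x := by ring
          _ ≤ _ := by gcongr
      linarith
    have step5 : b * ∫ x in Metric.ball 0 (R / 2), u x ≤ ∫ x, v x := by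
      rw [← integral_const_mul, ← integral_indicator measurableSet_ball]
      refine integral_mono ?_ hvi fun x => ?_
      · rw [integrable_indicator_iff measurableSet_ball]
        exact ((continuous_const.mul hu.continuous).continuousOn.integrableOn_compact
          (isCompact_closedBall (0 : E n) (R / 2))).mono_set Metric.ball_subset_closedBall
      · by_cases hx : x ∈ Metric.ball (0 : E n) (R / 2)
        · rw [Set.indicator_of_mem hx, mul_comm]
          refine mul_le_mul_of_nonneg_left (hb _ ?_) (hpos x).le
          rw [hnR, div_le_iff₀ hR0]
          have := mem_ball_zero_iff.1 hx
          linarith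
        · rw [Set.indicator_of_notMem hx]
          exact hv0 x
    refine le_of_mul_le_mul_left ((step5.trans step4).trans ?_) hb0
    have h7 : b * (ε * (R / 2) ^ n) = 2 * (M * ((V + 1) * R ^ n)) := by
      rw [hM, div_pow]
      field_simp
    rw [h7]
    gcongr
    linarith
  have h2 := (tendsto_id.const_mul_atTop (by norm_num : (0 : ℝ) < 2)).eventually main
  filter_upwards [h2] with R hR
  simpa using hR

end Averages

/-! ### From vanishing averages to an integral formula for `u` and its derivatives at 0. -/

section Representation

variable {n : ℕ}

/-! ### Representation of a positive solution by the Riesz potential -/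

/-- The functions `r^(-n) Ψ(z/r)` are an approximate identity of mass `∫ Ψ`; substituting `z = r w`
leaves a parametric integral continuous at `r = 0`. -/
lemma tendsto_integral_mul_rescale {g Ψ : E n → ℝ} (hg : Continuous g) (hΨ : Continuous Ψ)
    (hΨ1 : ∀ z, 1 < ‖z‖ → Ψ z = 0) :
    Tendsto (fun r : ℝ => ∫ z, g z * rescale n r Ψ z) (𝓝[>] 0) (𝓝 (g 0 * ∫ z, Ψ z)) := by
  have hcont : Continuous fun r : ℝ => ∫ w in Metric.closedBall (0 : E n) 1, g (r • w) * Ψ w := by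
    refine continuous_parametric_integral_of_continuous ?_ (isCompact_closedBall _ _)
    exact (hg.comp (continuous_fst.smul continuous_snd)).mul (hΨ.comp continuous_snd)
  have hset (h : E n → ℝ) : ∫ w in Metric.closedBall (0 : E n) 1, h w * Ψ w = ∫ w, h w * Ψ w := by
    refine setIntegral_eq_integral_of_forall_compl_eq_zero fun w hw => ?_
    rw [hΨ1 w (by simpa using hw), mul_zero]
  have h0 := (hcont.tendsto 0).mono_left (nhdsWithin_le_nhds (s := Set.Ioi 0))
  simp_rw [hset] at h0
  simp only [zero_smul, integral_const_mul] at h0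
  refine h0.congr' ?_
  filter_upwards [self_mem_nhdsWithin] with r (hr : 0 < r)
  have h := Measure.integral_comp_smul volume (fun w : E n => g (r • w) * Ψ w) r⁻¹
  simp only [smul_smul, mul_inv_cancel₀ hr.ne', one_smul, inv_pow, inv_inv, finrank_euclideanSpace,
    Fintype.card_fin, smul_eq_mul] at h
  rw [abs_of_pos (by positivity)] at h
  have h2 : ∀ z, g z * rescale n r Ψ z = r ^ (-(n : ℝ)) * (g z * Ψ (r⁻¹ • z)) := fun z => by
    rw [rescale]; ring
  simp_rw [h2]
  rw [integral_const_mul, h, Real.rpow_neg hr.le, Real.rpow_natCast]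
  field_simp

/-- At large scales the same functions only see averages of `u`, which vanish by `hdecay`. -/
lemma tendsto_integral_mul_rescale_atTop {u Ψ : E n → ℝ} (hu : Continuous u) (hpos : ∀ x, 0 < u x)
    (hdecay : ∀ ε > 0, ∀ᶠ R : ℝ in atTop, ∫ x in Metric.ball 0 R, u x ≤ ε * R ^ n)
    (hΨ : Continuous Ψ) (hΨ1 : ∀ z, 1 < ‖z‖ → Ψ z = 0) {d : ℝ} (hd : n ≤ d) :
    Tendsto (fun R : ℝ => ∫ z, u z * rescale d R Ψ z) atTop (𝓝 0) := by
  obtain ⟨B, hB⟩ := (isCompact_closedBall (0 : E n) 1).exists_bound_of_continuousOn hΨ.continuousOn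
  have hB0 : 0 ≤ B := (norm_nonneg _).trans (hB 0 (by simp))
  have hB' (z : E n) : |Ψ z| ≤ B := by
    rcases le_or_gt ‖z‖ 1 with h | h
    · exact hB z (by simpa using h)
    · simpa [hΨ1 z h] using hB0
  rw [Metric.tendsto_nhds]
  intro ε hε
  -- The open ball of radius `2R` contains the closed ball of radius `R` that supports the rescaled
  -- `Ψ`; the factor `2^n` pays for this.
  have h2 := (tendsto_id.const_mul_atTop (by norm_num : (0 : ℝ) < 2)).eventually
    (hdecay (ε / (2 * (B + 1) * 2 ^ n)) (by positivity))
  filter_upwards [h2, eventually_ge_atTop 1] with R hR hR1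
  have hR0 : 0 < R := by linarith
  simp only [id] at hR
  have hi : Integrable ((Metric.ball (0 : E n) (2 * R)).indicator u) := by
    rw [integrable_indicator_iff measurableSet_ball]
    exact (hu.continuousOn.integrableOn_compact
      (isCompact_closedBall (0 : E n) (2 * R))).mono_set Metric.ball_subset_closedBall
  have hpt (z : E n) : ‖u z * rescale d R Ψ z‖ ≤
      B * R ^ (-(n : ℝ)) * (Metric.ball (0 : E n) (2 * R)).indicator u z := by
    by_cases hz : ‖z‖ < 2 * R
    · rw [Set.indicator_of_mem (by simpa using hz), rescale, norm_mul, norm_mul,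
        Real.norm_of_nonneg (hpos z).le, Real.norm_of_nonneg (by positivity)]
      have h3 : R ^ (-d) ≤ R ^ (-(n : ℝ)) := Real.rpow_le_rpow_of_exponent_le hR1 (by linarith)
      have h4 := hB' (R⁻¹ • z)
      rw [← Real.norm_eq_abs] at h4
      have h5 := (hpos z).le
      calc u z * (R ^ (-d) * ‖Ψ (R⁻¹ • z)‖) ≤ u z * (R ^ (-(n : ℝ)) * B) := by gcongr
        _ = _ := by ring
    · have : Ψ (R⁻¹ • z) = 0 := by
        refine hΨ1 _ ?_
        rw [norm_smul, norm_inv, Real.norm_of_nonneg hR0.le, inv_mul_eq_div, one_lt_div hR0]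
        linarith
      rw [Set.indicator_of_notMem (by simpa using not_lt.1 hz), rescale, this]
      simp
  have h6 := norm_integral_le_of_norm_le (hi.const_mul _) (Eventually.of_forall hpt)
  rw [integral_const_mul, integral_indicator measurableSet_ball] at h6
  rw [dist_zero_right]
  have h7 : R ^ (-(n : ℝ)) * R ^ n = 1 := by
    rw [Real.rpow_neg hR0.le, Real.rpow_natCast, inv_mul_cancel₀ (by positivity)]
  calc _ ≤ B * R ^ (-(n : ℝ)) * ∫ x in Metric.ball 0 (2 * R), u x := h6
    _ ≤ B * R ^ (-(n : ℝ)) * (ε / (2 * (B + 1) * 2 ^ n) * (2 * R) ^ n) := by gcongr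
    _ = ε * (B / (B + 1)) / 2 * (R ^ (-(n : ℝ)) * R ^ n) := by
      rw [mul_pow]; field_simp
    _ ≤ ε * 1 / 2 * 1 := by
      rw [h7]
      gcongr
      rw [div_le_one (by positivity)]
      linarith
    _ < ε := by linarith

/-- Fatou's lemma. -/
lemma integrable_of_tendsto_of_nonneg {F : ℕ → E n → ℝ} {G : E n → ℝ} {L : ℝ}
    (hF : ∀ k, Integrable (F k)) (hF0 : ∀ k x, 0 ≤ F k x)
    (hlim : Tendsto (fun k => ∫ x, F k x) atTop (𝓝 L))
    (hG : ∀ᵐ x, Tendsto (fun k => F k x) atTop (𝓝 (G x))) : Integrable G := by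
  refine ⟨aestronglyMeasurable_of_tendsto_ae _ (fun k => (hF k).1) hG, ?_⟩
  have h1 : ∫⁻ x, ‖G x‖ₑ ≤ liminf (fun k => ∫⁻ x, ‖F k x‖ₑ) atTop := by
    refine (lintegral_congr_ae ?_).trans_le (lintegral_liminf_le' fun k => (hF k).1.enorm)
    filter_upwards [hG] with x hx using hx.enorm.liminf_eq.symm
  have h2 : Tendsto (fun k => ∫⁻ x, ‖F k x‖ₑ) atTop (𝓝 (ENNReal.ofReal L)) := by
    refine (ENNReal.tendsto_ofReal hlim).congr fun k => ?_
    rw [ofReal_integral_eq_lintegral_ofReal (hF k) (Eventually.of_forall (hF0 k))]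
    exact lintegral_congr fun x => (Real.enorm_of_nonneg (hF0 k x)).symm
  rw [h2.liminf_eq] at h1
  exact h1.trans_lt ENNReal.ofReal_lt_top

variable {m : ℕ} {u : E n → ℝ}

lemma negLaplacian_iterate_truncPow_eq_zero (hm : 0 < m) {z : E n} (hz : 1 < ‖z‖) :
    negLaplacian^[m] (truncPow ((n : ℝ) - 2 * m)) z = 0 := by
  refine (negLaplacian_iterate_eventuallyEq_zero (contDiff_truncPow _) hm ?_ ?_).eq_of_nhds
  · exact norm_pos_iff.1 (by linarith)
  · have h : rescale ((n : ℝ) - 2 * m) 1 (truncPow ((n : ℝ) - 2 * m)) =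
        (truncPow ((n : ℝ) - 2 * m) : E n → ℝ) := by
      ext y
      simp [rescale]
    exact h ▸ rescale_truncPow_eventuallyEq ((n : ℝ) - 2 * m) one_pos hz

/-- The difference of two truncations of `‖z‖⁻ᶜ`, at a small and at a large scale. -/
def annularPow (c : ℝ) (k : ℕ) (z : E n) : ℝ :=
  rescale c ((k : ℝ) + 1)⁻¹ (truncPow c) z - rescale c ((k : ℝ) + 1) (truncPow c) z

lemma contDiff_annularPow (c : ℝ) (k : ℕ) : ContDiff ℝ ∞ (annularPow c k : E n → ℝ) :=
  (contDiff_rescale (contDiff_truncPow c) _ _).sub (contDiff_rescale (contDiff_truncPow c) _ _)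

lemma hasCompactSupport_annularPow (c : ℝ) (k : ℕ) :
    HasCompactSupport (annularPow c k : E n → ℝ) := by
  refine HasCompactSupport.of_support_subset_isCompact
    (isCompact_closedBall (0 : E n) ((k : ℝ) + 1)) fun x hx => ?_
  rw [mem_closedBall_zero_iff]
  by_contra h
  have h1 : (k : ℝ) + 1 ≤ ‖x‖ := (not_le.1 h).le
  have h2 : ((k : ℝ) + 1)⁻¹ ≤ 1 := inv_le_one_of_one_le₀ (by simp)
  refine hx ?_
  rw [annularPow, rescale_truncPow_eq c (by positivity) h1,
    rescale_truncPow_eq c (by positivity) (by have : (0 : ℝ) ≤ k := by positivity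
                                              linarith), sub_self]

lemma annularPow_nonneg (c : ℝ) (k : ℕ) (z : E n) : 0 ≤ annularPow c k z := by
  refine sub_nonneg.2 (rescale_truncPow_anti c (by positivity) ?_ z)
  exact (inv_le_one_of_one_le₀ (by simp)).trans (by simp)

lemma tendsto_nat_add_one : Tendsto (fun k : ℕ => (k : ℝ) + 1) atTop atTop :=
  tendsto_atTop_add_const_right _ _ tendsto_natCast_atTop_atTop

lemma tendsto_dirDerivs_annularPow (c : ℝ) (l : List (E n)) {z : E n} (hz : z ≠ 0) :
    Tendsto (fun k => dirDerivs l (annularPow c k) z) atTop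
      (𝓝 (dirDerivs l (fun y => ‖y‖ ^ (-c)) z)) := by
  have hz0 : 0 < ‖z‖ := norm_pos_iff.2 hz
  refine tendsto_const_nhds.congr' ?_
  filter_upwards [tendsto_nat_add_one.eventually (eventually_gt_atTop (2 * ‖z‖)),
    (tendsto_inv_atTop_zero.comp tendsto_nat_add_one).eventually (gt_mem_nhds hz0)] with k h1 h2
  refine (dirDerivs_eventuallyEq ?_ l).eq_of_nhds
  have hk : (0 : ℝ) < (k : ℝ) + 1 := by positivity
  filter_upwards [rescale_truncPow_eventuallyEq c (inv_pos.2 hk) h2,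
    rescale_truncPow_eventuallyEq_zero c (by positivity)
      (show ‖z‖ < ((k : ℝ) + 1) / 2 by linarith)] with y hy1 hy2
  rw [annularPow, hy1, hy2, sub_zero]

lemma exists_abs_dirDerivs_annularPow_le {c : ℝ} (hc : 0 ≤ c) (l : List (E n)) :
    ∃ B : ℝ, ∀ (k : ℕ) (z : E n), z ≠ 0 →
      |dirDerivs l (annularPow c k) z| ≤ B * ‖z‖ ^ (-(c + l.length)) := by
  obtain ⟨B, hB⟩ := exists_abs_dirDerivs_rescale_truncPow_le hc l
  refine ⟨2 * B, fun k z hz => ?_⟩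
  have h1 := hB ((k : ℝ) + 1)⁻¹ (by positivity) z hz
  have h2 := hB ((k : ℝ) + 1) (by positivity) z hz
  have h3 : dirDerivs l (annularPow c k) z = _ := congrFun
    (dirDerivs_sub (contDiff_rescale (contDiff_truncPow c) c ((k : ℝ) + 1)⁻¹)
      (contDiff_rescale (contDiff_truncPow c) c ((k : ℝ) + 1)) l) z
  rw [h3]
  exact (abs_sub _ _).trans (by linarith)

/-- With `Ψ = (-Δ)^m (truncPow a)`, the operator sends `annularPow a k` to `Ψ` at scale `1/(k+1)`
minus `Ψ` at scale `k+1`. The first piece is an approximate identity, with its derivatives moved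
onto `u`. The second keeps its derivatives, which only improves the scaling, and tends to 0 by the
decay of averages. -/
lemma tendsto_integral_mul_dirDerivs_annularPow (hm : 0 < m) (hu : ContDiff ℝ ∞ u)
    (hpos : ∀ x, 0 < u x)
    (hdecay : ∀ ε > 0, ∀ᶠ R : ℝ in atTop, ∫ x in Metric.ball 0 R, u x ≤ ε * R ^ n)
    (l : List (E n)) :
    Tendsto (fun k => ∫ z, negLaplacian^[m] u z * dirDerivs l (annularPow ((n : ℝ) - 2 * m) k) z)
      atTop (𝓝 ((-1) ^ l.length *
        (dirDerivs l u 0 * ∫ z : E n, negLaplacian^[m] (truncPow ((n : ℝ) - 2 * m)) z))) := by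
  set a : ℝ := (n : ℝ) - 2 * m with ha
  set Ψ : E n → ℝ := negLaplacian^[m] (truncPow a) with hΨ
  have hκ := contDiff_truncPow (n := n) a
  have hΨs : ContDiff ℝ ∞ Ψ := contDiff_negLaplacian_iterate hκ m
  have hΨ1 (z : E n) (hz : 1 < ‖z‖) : Ψ z = 0 := negLaplacian_iterate_truncPow_eq_zero hm hz
  have hΨl (z : E n) (hz : 1 < ‖z‖) : dirDerivs l Ψ z = 0 := by
    have : Ψ =ᶠ[𝓝 z] fun _ => 0 := by
      filter_upwards [continuousAt_id.norm.eventually (lt_mem_nhds hz)] with y hy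
      exact hΨ1 y hy
    rw [(dirDerivs_eventuallyEq this l).eq_of_nhds, dirDerivs_zero]
  have hsupp {r : ℝ} (hr : 0 < r) : HasCompactSupport (rescale n r Ψ) := by
    refine HasCompactSupport.of_support_subset_isCompact (isCompact_closedBall (0 : E n) r)
      fun x hx => ?_
    rw [mem_closedBall_zero_iff]
    by_contra h
    refine hx ?_
    rw [rescale, hΨ1, mul_zero]
    rw [norm_smul, norm_inv, Real.norm_of_nonneg hr.le, inv_mul_eq_div]
    exact (one_lt_div hr).2 (not_le.1 h)
  have hKs (k : ℕ) := contDiff_annularPow (n := n) a k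
  have e1 (k : ℕ) : ∫ z, negLaplacian^[m] u z * dirDerivs l (annularPow a k) z =
      (-1) ^ l.length * (∫ z, dirDerivs l u z * rescale n ((k : ℝ) + 1)⁻¹ Ψ z) -
        ∫ z, u z * rescale (n + l.length) ((k : ℝ) + 1) (dirDerivs l Ψ) z := by
    have hk : (0 : ℝ) < (k : ℝ) + 1 := by positivity
    rw [← integral_mul_negLaplacian_iterate hu (contDiff_dirDerivs (hKs k) l)
      (hasCompactSupport_dirDerivs (hasCompactSupport_annularPow a k) l),
      negLaplacian_iterate_dirDerivs (hKs k)]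
    have h1 : negLaplacian^[m] (annularPow a k) =
        fun z : E n => rescale n ((k : ℝ) + 1)⁻¹ Ψ z - rescale n ((k : ℝ) + 1) Ψ z := by
      have h2 : a + 2 * m = n := by rw [ha]; ring
      have h3 := negLaplacian_iterate_sub (contDiff_rescale hκ a ((k : ℝ) + 1)⁻¹)
        (contDiff_rescale hκ a ((k : ℝ) + 1)) m
      rw [negLaplacian_iterate_rescale hκ a (inv_pos.2 hk),
        negLaplacian_iterate_rescale hκ a hk, h2] at h3
      exact h3
    rw [h1, dirDerivs_sub (contDiff_rescale hΨs _ _) (contDiff_rescale hΨs _ _)]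
    simp_rw [mul_sub]
    rw [integral_sub, integral_mul_dirDerivs hu (contDiff_rescale hΨs _ _) (hsupp (inv_pos.2 hk)),
      dirDerivs_rescale hΨs _ hk]
    · exact (hu.continuous.mul (contDiff_dirDerivs (contDiff_rescale hΨs _ _) l).continuous
        ).integrable_of_hasCompactSupport
          (hasCompactSupport_dirDerivs (hsupp (inv_pos.2 hk)) l).mul_left
    · exact (hu.continuous.mul (contDiff_dirDerivs (contDiff_rescale hΨs _ _) l).continuous
        ).integrable_of_hasCompactSupport (hasCompactSupport_dirDerivs (hsupp hk) l).mul_left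
  simp_rw [e1]
  have t1 : Tendsto (fun k : ℕ => ((k : ℝ) + 1)⁻¹) atTop (𝓝[>] 0) :=
    tendsto_inv_atTop_nhdsGT_zero.comp tendsto_nat_add_one
  have t2 := (tendsto_integral_mul_rescale (contDiff_dirDerivs hu l).continuous hΨs.continuous
    hΨ1).comp t1
  have t3 := (tendsto_integral_mul_rescale_atTop (d := n + l.length) hu.continuous hpos hdecay
    (contDiff_dirDerivs hΨs l).continuous hΨl (by simp)).comp tendsto_nat_add_one
  simpa using (t2.const_mul ((-1) ^ l.length)).sub t3

/-- Positivity of `f` and Fatou give integrability of `f |z|^(-a)`; dominated convergence then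
passes to the limit in the truncated identities. The constant is `∫ (-Δ)^m (truncPow a)`, whose sign
is not determined here. -/
theorem riesz_representation (hm : 0 < m) (hmn : 2 * m < n) (hu : ContDiff ℝ ∞ u)
    (hpos : ∀ x, 0 < u x) (hf : ∀ x, 0 < negLaplacian^[m] u x)
    (hdecay : ∀ ε > 0, ∀ᶠ R : ℝ in atTop, ∫ x in Metric.ball 0 R, u x ≤ ε * R ^ n) :
    ∃ C : ℝ, (∀ j : ℕ, j < 2 * m →
        Integrable fun z => negLaplacian^[m] u z * ‖z‖ ^ (-((n : ℝ) - 2 * m + j))) ∧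
      ∀ l : List (E n), l.length < 2 * m →
        Integrable (fun z => negLaplacian^[m] u z *
          dirDerivs l (fun y => ‖y‖ ^ (-((n : ℝ) - 2 * m))) z) ∧
        (-1) ^ l.length * ∫ z, negLaplacian^[m] u z *
          dirDerivs l (fun y => ‖y‖ ^ (-((n : ℝ) - 2 * m))) z = C * dirDerivs l u 0 := by
  set a : ℝ := (n : ℝ) - 2 * m with ha
  have ha0 : 0 < a := by
    have : (2 * m : ℝ) < n := by exact_mod_cast hmn
    linarith
  have hfc := (contDiff_negLaplacian_iterate hu m).continuous
  have hne : ∀ᵐ z : E n, z ≠ 0 := by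
    have : Nonempty (Fin n) := ⟨⟨0, by lia⟩⟩
    exact Measure.ae_ne volume 0
  have h0 : Integrable fun z => negLaplacian^[m] u z * ‖z‖ ^ (-a) := by
    refine integrable_of_tendsto_of_nonneg (fun k => ?_)
      (fun k x => mul_nonneg (hf x).le (annularPow_nonneg a k x))
      (tendsto_integral_mul_dirDerivs_annularPow hm hu hpos hdecay []) ?_
    · exact (hfc.mul (contDiff_annularPow a k).continuous).integrable_of_hasCompactSupport
        (hasCompactSupport_annularPow a k).mul_left
    · filter_upwards [hne] with z hz
      exact (tendsto_dirDerivs_annularPow a [] hz).const_mul _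
  have hj (j : ℕ) (hj : j < 2 * m) :
      Integrable fun z => negLaplacian^[m] u z * ‖z‖ ^ (-(a + j)) := by
    have hmeas : AEStronglyMeasurable
        (fun z : E n => negLaplacian^[m] u z * ‖z‖ ^ (-(a + j))) volume :=
      (hfc.measurable.mul (measurable_norm.pow_const _)).aestronglyMeasurable
    -- Inside the unit ball `a + j < n` suffices; outside it `|z|^(-a-j) ≤ |z|^(-a)`.
    rw [← integrableOn_univ, ← Set.union_compl_self (Metric.ball (0 : E n) 1), integrableOn_union]
    constructor
    · obtain ⟨B, hB⟩ := (isCompact_closedBall (0 : E n) 1).exists_bound_of_continuousOn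
        hfc.continuousOn
      refine integrableOn_ball_of_norm_le_rpow (C := B) (α := a + j) ?_ ?_ ?_ hmeas
      · simp; lia
      · have : (j : ℝ) < 2 * m := by exact_mod_cast hj
        simp
        linarith
      · refine (ae_restrict_iff' measurableSet_ball).2 (Eventually.of_forall fun z hz => ?_)
        rw [norm_mul, Real.norm_of_nonneg (r := ‖z‖ ^ _) (by positivity)]
        gcongr
        exact hB z (Metric.ball_subset_closedBall hz)
    · refine Integrable.mono' h0.integrableOn hmeas.restrict ?_
      refine (ae_restrict_iff' measurableSet_ball.compl).2 (Eventually.of_forall fun z hz => ?_)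
      have hz1 : 1 ≤ ‖z‖ := by simpa using hz
      rw [Real.norm_of_nonneg (mul_nonneg (hf z).le (by positivity))]
      refine mul_le_mul_of_nonneg_left (Real.rpow_le_rpow_of_exponent_le hz1 ?_) (hf z).le
      have : (0 : ℝ) ≤ j := by positivity
      linarith
  refine ⟨∫ z : E n, negLaplacian^[m] (truncPow a) z, hj, fun l hl => ?_⟩
  obtain ⟨B, hB⟩ := exists_abs_dirDerivs_annularPow_le (n := n) ha0.le l
  have hint := (hj _ hl).const_mul B
  have hmeas (k : ℕ) : AEStronglyMeasurable
      (fun z => negLaplacian^[m] u z * dirDerivs l (annularPow a k) z) :=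
    (hfc.mul (contDiff_dirDerivs (contDiff_annularPow a k) l).continuous).aestronglyMeasurable
  have hbound (k : ℕ) : ∀ᵐ z, ‖negLaplacian^[m] u z * dirDerivs l (annularPow a k) z‖ ≤
      B * (negLaplacian^[m] u z * ‖z‖ ^ (-(a + l.length))) := by
    filter_upwards [hne] with z hz
    rw [norm_mul, Real.norm_of_nonneg (hf z).le]
    refine (mul_le_mul_of_nonneg_left (hB k z hz) (hf z).le).trans_eq ?_
    ring
  have hlim : ∀ᵐ z, Tendsto (fun k => negLaplacian^[m] u z * dirDerivs l (annularPow a k) z) atTop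
      (𝓝 (negLaplacian^[m] u z * dirDerivs l (fun y => ‖y‖ ^ (-a)) z)) := by
    filter_upwards [hne] with z hz
    exact (tendsto_dirDerivs_annularPow a l hz).const_mul _
  have t1 := tendsto_integral_of_dominated_convergence _ hmeas hint hbound hlim
  refine ⟨hint.mono' (aestronglyMeasurable_of_tendsto_ae _ hmeas hlim) ?_, ?_⟩
  · filter_upwards [hlim, ae_all_iff.2 hbound] with z hz hbz
    exact le_of_tendsto hz.norm (Eventually.of_forall hbz)
  rw [tendsto_nhds_unique t1
    (tendsto_integral_mul_dirDerivs_annularPow hm hu hpos hdecay l), ← mul_assoc, ← mul_pow,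
    neg_mul_neg, one_mul, one_pow, one_mul, mul_comm]

end Representation

/-! ### Derivatives of `u` at 0 as moments of `z/|z|²` under a positive weight. -/

section Moments

variable {n : ℕ}

/-! ### Derivatives of a solution as moments -/

lemma dirDerivs_const_mul_norm_rpow (c A : ℝ) (l : List (E n)) {z : E n} (hz : z ≠ 0) :
    dirDerivs l (fun y : E n => A * ‖y‖ ^ (-c)) z = A * dirDerivs l (fun y => ‖y‖ ^ (-c)) z := by
  obtain ⟨f, hf, hfz⟩ := exists_contDiff_eventuallyEq_norm_rpow c hz
  have h : (fun y : E n => A * f y) =ᶠ[𝓝 z] fun y => A * ‖y‖ ^ (-c) := by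
    filter_upwards [hfz] with y hy
    rw [hy]
  rw [← (dirDerivs_eventuallyEq h l).eq_of_nhds, dirDerivs_const_mul hf,
    ← (dirDerivs_eventuallyEq hfz l).eq_of_nhds]

/-- The squared norm of the inverted point `z / |z|²`. -/
def invSq (z : E n) : ℝ := (‖z‖ ^ 2)⁻¹

/-- The coordinates of the inverted point `z / |z|²`. -/
def invCoord (i : Fin n) (z : E n) : ℝ := invSq z * z i

lemma invSq_nonneg (z : E n) : 0 ≤ invSq z := by unfold invSq; positivity

lemma measurable_invSq : Measurable (invSq : E n → ℝ) := (measurable_norm.pow_const 2).inv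

lemma measurable_invCoord (i : Fin n) : Measurable (invCoord i : E n → ℝ) :=
  measurable_invSq.mul (EuclideanSpace.proj (𝕜 := ℝ) i).measurable

lemma sum_invCoord_sq (z : E n) : ∑ i, invCoord i z ^ 2 = invSq z := by
  simp_rw [invCoord, mul_pow]
  rw [← Finset.mul_sum, ← EuclideanSpace.real_norm_sq_eq, invSq]
  by_cases hz : ‖z‖ = 0
  · simp [hz]
  · field_simp

lemma abs_invCoord_le (i : Fin n) (z : E n) : |invCoord i z| ≤ ‖z‖⁻¹ := by
  have h : invCoord i z ^ 2 ≤ invSq z := by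
    rw [← sum_invCoord_sq]
    exact Finset.single_le_sum (f := fun i => invCoord i z ^ 2) (fun i _ => sq_nonneg _)
      (Finset.mem_univ i)
  refine abs_le_of_sq_le_sq (h.trans_eq ?_) (by positivity)
  rw [invSq, inv_pow]

lemma norm_rpow_add_two (a : ℝ) {z : E n} (hz : z ≠ 0) :
    ‖z‖ ^ (-(a + 2)) = ‖z‖ ^ (-a) * invSq z := by
  rw [neg_add, Real.rpow_add (norm_pos_iff.2 hz), Real.rpow_neg (norm_nonneg z) 2, invSq]
  norm_cast

lemma integrable_weight_mul {w g : E n → ℝ} (hw : Measurable w) (hg : Measurable g) {j : ℕ}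
    (hj : Integrable fun z => w z * ‖z‖⁻¹ ^ j) (hle : ∀ z, |g z| ≤ ‖z‖⁻¹ ^ j) :
    Integrable fun z => w z * g z := by
  refine hj.mono (hw.mul hg).aestronglyMeasurable (Eventually.of_forall fun z => ?_)
  rw [norm_mul, norm_mul, Real.norm_eq_abs (g z), Real.norm_of_nonneg (r := ‖z‖⁻¹ ^ j) (by positivity)]
  gcongr
  exact hle z

lemma invSq_eq (z : E n) : invSq z = ‖z‖⁻¹ ^ 2 := by rw [invSq, inv_pow]

lemma abs_invSq_le (z : E n) : |invSq z| ≤ ‖z‖⁻¹ ^ 2 := by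
  rw [abs_of_nonneg (invSq_nonneg z), invSq_eq]

lemma abs_invCoord_mul_le (i j : Fin n) (z : E n) :
    |invCoord i z * invCoord j z| ≤ ‖z‖⁻¹ ^ 2 := by
  rw [abs_mul, sq]
  exact mul_le_mul (abs_invCoord_le i z) (abs_invCoord_le j z) (abs_nonneg _) (by positivity)

variable {m : ℕ} {u : E n → ℝ}

/-- Each derivative of `|z|^(-a)` is `|z|^(-a)` times a polynomial in `y = z/|z|²`, so `w = C⁻¹ f
|z|^(-a)` serves for all of them. The last clause asks `3 ≤ m` because order 4 must stay below `2m`.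
-/
lemma exists_weight (hm : 2 ≤ m) (hmn : 2 * m < n) (hu : ContDiff ℝ ∞ u)
    (hpos : ∀ x, 0 < u x) (hf : ∀ x, 0 < negLaplacian^[m] u x)
    (hdecay : ∀ ε > 0, ∀ᶠ R : ℝ in atTop, ∫ x in Metric.ball 0 R, u x ≤ ε * R ^ n)
    {a : ℝ} (ha : a = n - 2 * m) :
    ∃ w : E n → ℝ, (∀ z, z ≠ 0 → 0 < w z) ∧ Measurable w ∧
      (∀ j : ℕ, j < 2 * m → Integrable fun z => w z * ‖z‖⁻¹ ^ j) ∧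
      u 0 = ∫ z, w z ∧
      (∀ i, dirDeriv (stdVec i) u 0 = a * ∫ z, w z * invCoord i z) ∧
      (∀ i j, dirDeriv (stdVec j) (dirDeriv (stdVec i) u) 0 =
        a * (a + 2) * (∫ z, w z * (invCoord i z * invCoord j z))
          - a * (if i = j then 1 else 0) * ∫ z, w z * invSq z) ∧
      (3 ≤ m → (∀ j, ∑ i, dirDerivs [stdVec j, stdVec i, stdVec i] u 0 =
          -(a * (2 * m - 2) * (a + 2)) * ∫ z, w z * (invSq z * invCoord j z)) ∧
        ∑ i, ∑ j, dirDerivs [stdVec i, stdVec i, stdVec j, stdVec j] u 0 =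
          a * (2 * m - 2) * (a + 2) * (2 * m - 4) * ∫ z, w z * invSq z ^ 2) := by
  obtain ⟨C, hint, hrep⟩ := riesz_representation (by lia) hmn hu hpos hf hdecay
  rw [← ha] at hint hrep
  have hfc := (contDiff_negLaplacian_iterate hu m).continuous
  set f := negLaplacian^[m] u
  have ha0 : 0 < a := by
    have : (2 * m : ℝ) < n := by exact_mod_cast hmn
    linarith
  have hne : ∀ᵐ z : E n, z ≠ 0 := by
    have : Nonempty (Fin n) := ⟨⟨0, by lia⟩⟩
    exact Measure.ae_ne volume 0
  -- The formula of order zero reads `∫ f |z|^(-a) = C u(0)`, with the integral and `u(0)` both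
  -- positive.
  have hC : 0 < C := by
    have h1 := (hrep [] (by simp; lia)).2
    simp only [List.length_nil, pow_zero, one_mul, dirDerivs_nil] at h1
    have h2 : 0 < ∫ z, f z * ‖z‖ ^ (-a) := by
      have hi := hint 0 (by lia)
      simp only [Nat.cast_zero, add_zero] at hi
      refine lt_of_le_of_ne (integral_nonneg fun z => mul_nonneg (hf z).le (by positivity)) fun h => ?_
      have h3 := (integral_eq_zero_iff_of_nonneg
        (fun z => mul_nonneg (hf z).le (by positivity)) hi).1 h.symm
      obtain ⟨z, hz1, hz2⟩ := (h3.and hne).exists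
      exact (mul_pos (hf z) (Real.rpow_pos_of_pos (norm_pos_iff.2 hz2) _)).ne' hz1
    rw [h1] at h2
    exact pos_of_mul_pos_left h2 (hpos 0).le
  have hkey (l : List (E n)) (hl : l.length < 2 * m) :
      dirDerivs l u 0 = (-1) ^ l.length * ∫ z, C⁻¹ * f z * dirDerivs l (fun y => ‖y‖ ^ (-a)) z := by
    have h1 := (hrep l hl).2
    simp_rw [mul_assoc, integral_const_mul]
    rw [mul_left_comm, h1]
    field_simp
  have hi (l : List (E n)) (hl : l.length < 2 * m) :
      Integrable fun z => C⁻¹ * f z * dirDerivs l (fun y => ‖y‖ ^ (-a)) z := by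
    simp_rw [mul_assoc]
    exact (hrep l hl).1.const_mul _
  have hin (z : E n) (i : Fin n) : inner ℝ z (stdVec i) = z i := by
    simp [EuclideanSpace.inner_single_right]
  have hcast : (n : ℝ) - a - 2 = 2 * m - 2 := by rw [ha]; ring
  have hcast' : (n : ℝ) - (a + 2) - 2 = 2 * m - 4 := by rw [ha]; ring
  have hmeas : Measurable fun z : E n => C⁻¹ * f z * ‖z‖ ^ (-a) :=
    (hfc.measurable.const_mul _).mul (measurable_norm.pow_const _)
  have hwj (j : ℕ) (hj : j < 2 * m) : Integrable fun z => C⁻¹ * f z * ‖z‖ ^ (-a) * ‖z‖⁻¹ ^ j := by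
    refine ((hint j hj).const_mul C⁻¹).congr ?_
    filter_upwards [hne] with z hz
    rw [neg_add, Real.rpow_add (norm_pos_iff.2 hz), Real.rpow_neg (norm_nonneg z) j,
      Real.rpow_natCast, inv_pow]
    ring
  refine ⟨fun z => C⁻¹ * f z * ‖z‖ ^ (-a), fun z hz => ?_, hmeas, hwj, ?_, fun i => ?_,
    fun i j => ?_, fun hm3 => ⟨fun j => ?_, ?_⟩⟩
  · have := hf z
    have := Real.rpow_pos_of_pos (norm_pos_iff.2 hz) (-a)
    positivity
  · simpa using hkey [] (by simp; lia)
  · have h := hkey [stdVec i] (by simp; lia)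
    simp only [dirDerivs_cons, dirDerivs_nil, List.length_singleton, pow_one] at h
    rw [h, ← integral_const_mul, ← integral_const_mul]
    refine integral_congr_ae ?_
    filter_upwards [hne] with z hz
    rw [dirDeriv_norm_rpow a _ hz, norm_rpow_add_two a hz, hin, invCoord]
    ring
  · have h := hkey [stdVec j, stdVec i] (by simp; lia)
    simp only [dirDerivs_cons, dirDerivs_nil, List.length_cons, List.length_nil] at h
    have i1 := integrable_weight_mul (g := fun z => invCoord i z * invCoord j z) hmeas 
      ((measurable_invCoord i).mul (measurable_invCoord j)) (hwj 2 (by lia)) (abs_invCoord_mul_le i j)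
    have i2 := integrable_weight_mul hmeas measurable_invSq (hwj 2 (by lia)) abs_invSq_le
    rw [h, ← integral_const_mul, ← integral_const_mul, ← integral_const_mul,
      ← integral_sub (i1.const_mul (a * (a + 2))) (i2.const_mul _)]
    refine integral_congr_ae ?_
    filter_upwards [hne] with z hz
    have h4 : ‖z‖ ^ (-(a + 4)) = ‖z‖ ^ (-a) * invSq z * invSq z := by
      rw [show a + 4 = a + 2 + 2 by ring, norm_rpow_add_two _ hz, norm_rpow_add_two _ hz]
    have h5 : inner ℝ (stdVec j : E n) (stdVec i) = (if i = j then 1 else 0 : ℝ) := by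
      simp [EuclideanSpace.inner_single_right]
    rw [dirDeriv_dirDeriv_norm_rpow a _ _ hz, norm_rpow_add_two a hz, h4, h5, hin, hin,
      invCoord, invCoord]
    ring
  · have h := fun i => hkey [stdVec j, stdVec i, stdVec i] (by simp; lia)
    simp_rw [h]
    simp only [List.length_cons, List.length_nil]
    rw [← Finset.mul_sum, ← integral_finsetSum _ fun i _ => hi _ (by simp; lia),
      ← integral_const_mul, ← integral_const_mul]
    refine integral_congr_ae ?_
    filter_upwards [hne] with z hz
    have h2 := sum_dirDerivs_norm_rpow_eq_negLaplacian a [stdVec j] hz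
    simp only [List.cons_append, List.nil_append] at h2
    rw [← Finset.mul_sum, h2, dirDerivs_const_mul_norm_rpow _ _ _ hz, dirDerivs_cons, dirDerivs_nil,
      dirDeriv_norm_rpow _ _ hz, norm_rpow_add_two _ hz, norm_rpow_add_two _ hz, hcast, hin, invCoord]
    ring
  · have h := fun i j => hkey [stdVec i, stdVec i, stdVec j, stdVec j] (by simp; lia)
    simp_rw [h]
    simp only [List.length_cons, List.length_nil]
    simp_rw [← Finset.mul_sum]
    have h1 (i : Fin n) := integral_finsetSum Finset.univ fun j _ =>
      hi [stdVec i, stdVec i, stdVec j, stdVec j] (by simp; lia)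
    simp_rw [← h1]
    rw [← integral_finsetSum _ fun i _ => integrable_finsetSum _ fun j _ => hi _ (by simp; lia),
      ← integral_const_mul, ← integral_const_mul]
    refine integral_congr_ae ?_
    filter_upwards [hne] with z hz
    have h2 (i : Fin n) := sum_dirDerivs_norm_rpow_eq_negLaplacian a [stdVec i, stdVec i] hz
    simp only [List.cons_append, List.nil_append, dirDerivs_const_mul_norm_rpow _ _ _ hz] at h2
    have h3 := sum_dirDeriv_dirDeriv_norm_rpow (a + 2) hz
    simp_rw [← Finset.mul_sum, h2, ← Finset.mul_sum, dirDerivs_cons, dirDerivs_nil]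
    rw [h3, norm_rpow_add_two _ hz, norm_rpow_add_two _ hz, hcast, hcast']
    ring

end Moments

/-! ### Variance and fourth central moment, and the two differential inequalities. -/

section MomentInequalities

variable {n : ℕ}

/-! ### Moment inequalities -/

/-- The function `g` is integrable against the weight `w`, with integral `v`. -/
def HasMoment (w g : E n → ℝ) (v : ℝ) : Prop :=
  Integrable (fun z => w z * g z) ∧ ∫ z, w z * g z = v

lemma HasMoment.add {w g h : E n → ℝ} {v v' : ℝ} (hg : HasMoment w g v) (hh : HasMoment w h v') :
    HasMoment w (fun z => g z + h z) (v + v') := by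
  refine ⟨?_, ?_⟩
  · simp_rw [mul_add]
    exact hg.1.add hh.1
  · simp_rw [mul_add]
    rw [integral_add hg.1 hh.1, hg.2, hh.2]

lemma HasMoment.const_mul {w g : E n → ℝ} {v : ℝ} (hg : HasMoment w g v) (c : ℝ) :
    HasMoment w (fun z => c * g z) (c * v) := by
  simp only [HasMoment, mul_left_comm _ c]
  exact ⟨hg.1.const_mul c, by rw [integral_const_mul, hg.2]⟩

lemma HasMoment.sum {ι : Type*} {s : Finset ι} {w : E n → ℝ} {g : ι → E n → ℝ} {v : ι → ℝ}
    (hg : ∀ i ∈ s, HasMoment w (g i) (v i)) :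
    HasMoment w (fun z => ∑ i ∈ s, g i z) (∑ i ∈ s, v i) := by
  simp only [HasMoment, Finset.mul_sum]
  refine ⟨integrable_finsetSum _ fun i hi => (hg i hi).1, ?_⟩
  rw [integral_finsetSum _ fun i hi => (hg i hi).1]
  exact Finset.sum_congr rfl fun i hi => (hg i hi).2

/-- Here `c = 2m - 2`, `b` is the mean of `y`, `U` the mass, and `B`, `bHb`, `bV`, `HH` stand for
`|b|²`, `⟨b, Hb⟩`, `⟨b, V⟩`, `|H|²`. Rewritten in central moments, the expression loses all gradient
terms: it is a multiple of the fourth central moment (`h₄`), plus a multiple of the squared variance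
(`h₂`) and of a squared Frobenius norm (`hT`). The identity uses `N = a + c + 2`. -/
lemma quartic_pos {a c U S₂ S₄ B bV bHb HH N : ℝ} (ha : 0 < a) (hc : 2 < c) (hU : 0 < U)
    (hN : N = a + c + 2) (h₂ : 0 < S₂ - U * B)
    (h₄ : 0 ≤ S₄ + 4 * bHb - 3 * U * B ^ 2 - 4 * bV + 2 * B * S₂)
    (hT : 0 ≤ (a * (a + 2)) ^ 2 * (HH - 2 * U * bHb + U ^ 2 * B ^ 2)
      - 2 * a ^ 2 * (a + 2) * (S₂ - U * B) ^ 2 + a ^ 2 * (S₂ - U * B) ^ 2 * N) :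
    0 < U ^ 3 * (a * c * (a + 2) * (c - 2) * S₄)
      + (c - 2) / a * U ^ 2 * ((-(a * c * S₂)) ^ 2
        + 2 * ((a * (a + 2)) ^ 2 * HH - 2 * a ^ 2 * (a + 2) * S₂ ^ 2 + N * a ^ 2 * S₂ ^ 2)
        + 4 * (-(a ^ 2 * U * c * (a + 2) * bV)))
      + (c - 2) / a * ((c - 2) / a - 1) * U * (2 * (a ^ 2 * U ^ 2 * B) * (-(a * c * S₂))
        + 4 * (a ^ 2 * U ^ 2 * (a * (a + 2) * bHb - a * S₂ * B)))
      + (c - 2) / a * ((c - 2) / a - 1) * ((c - 2) / a - 2) * (a ^ 2 * U ^ 2 * B) ^ 2 := by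
  have hc' : 0 < c - 2 := by linarith
  have hc0 : 0 < c := by linarith
  have key : 0 < U ^ 3 * (a * c * (a + 2) * (c - 2)) *
        (S₄ + 4 * bHb - 3 * U * B ^ 2 - 4 * bV + 2 * B * S₂)
      + (c - 2) / a * U ^ 2 * (a ^ 2 * c ^ 2 * (S₂ - U * B) ^ 2
        + 2 * ((a * (a + 2)) ^ 2 * (HH - 2 * U * bHb + U ^ 2 * B ^ 2)
      - 2 * a ^ 2 * (a + 2) * (S₂ - U * B) ^ 2 + a ^ 2 * (S₂ - U * B) ^ 2 * N)) := by
    have h3 : 0 < a ^ 2 * c ^ 2 * (S₂ - U * B) ^ 2 := by positivity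
    have h5 : 0 < (c - 2) / a * U ^ 2 := by positivity
    exact add_pos_of_nonneg_of_pos (mul_nonneg (by positivity) h₄) (mul_pos h5 (by linarith))
  convert key using 1
  rw [hN]
  field_simp
  ring

/-- The first and last claims expand `∫ w |y - b|²` and `∫ w |y - b|⁴`, where `b` is the mean of
`y`. The middle one is `∑ y_i² = |y|²`. -/
lemma exists_moments {w : E n → ℝ} [Nonempty (Fin n)] (hw : ∀ z, z ≠ 0 → 0 < w z) (hwm : Measurable w)
    {d : ℕ} (hd : 3 ≤ d) (hint : ∀ j : ℕ, j < d → Integrable fun z => w z * ‖z‖⁻¹ ^ j) {b : Fin n → ℝ}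
    (hb : ∀ i, ∫ z, w z * invCoord i z = (∫ z, w z) * b i) :
    0 < (∫ z, w z * invSq z) - (∫ z, w z) * ∑ i, b i ^ 2 ∧
    ∑ i, ∫ z, w z * (invCoord i z * invCoord i z) = ∫ z, w z * invSq z ∧
    (5 ≤ d → 0 ≤ (∫ z, w z * invSq z ^ 2)
      + 4 * (∑ i, ∑ j, b i * b j * ∫ z, w z * (invCoord i z * invCoord j z))
      - 3 * (∫ z, w z) * (∑ i, b i ^ 2) ^ 2 - 4 * (∑ i, b i * ∫ z, w z * (invSq z * invCoord i z))
      + 2 * (∑ i, b i ^ 2) * ∫ z, w z * invSq z) := by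
  set U := ∫ z, w z
  set B := ∑ i, b i ^ 2 with hB
  have hne (p : E n) : ∀ᵐ z : E n, z ≠ p := Measure.ae_ne volume p
  have hw0 : ∀ᵐ z, 0 ≤ w z := by
    filter_upwards [hne 0] with z hz using (hw z hz).le
  have m0 : HasMoment w (fun _ => 1) U := by
    refine ⟨by simpa using hint 0 (by lia), by simp [U]⟩
  have m1 (i : Fin n) : HasMoment w (invCoord i) (U * b i) :=
    ⟨integrable_weight_mul hwm (measurable_invCoord i) (hint 1 (by lia))
      (by simpa using abs_invCoord_le i), hb i⟩
  have m2 : HasMoment w invSq (∫ z, w z * invSq z) :=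
    ⟨integrable_weight_mul hwm measurable_invSq (hint 2 (by lia)) abs_invSq_le, rfl⟩
  have mH (i j : Fin n) : HasMoment w (fun z => invCoord i z * invCoord j z)
      (∫ z, w z * (invCoord i z * invCoord j z)) :=
    ⟨integrable_weight_mul hwm ((measurable_invCoord i).mul (measurable_invCoord j))
      (hint 2 (by lia)) (abs_invCoord_mul_le i j), rfl⟩
  have hdev (z : E n) : ∑ i, (invCoord i z - b i) ^ 2 = invSq z + (-2) * ∑ i, b i * invCoord i z + B := by
    rw [← sum_invCoord_sq, Finset.mul_sum, hB, ← Finset.sum_add_distrib, ← Finset.sum_add_distrib]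
    exact Finset.sum_congr rfl fun i _ => by ring
  refine ⟨?_, ?_, fun h5 => ?_⟩
  · have h := (m2.add ((HasMoment.sum (s := Finset.univ) fun i _ =>
      (m1 i).const_mul (b i)).const_mul (-2))).add
      (m0.const_mul B)
    simp_rw [mul_one, ← hdev] at h
    have e : (∫ z, w z * invSq z) + -2 * (∑ i, b i * (U * b i)) + B * U
        = (∫ z, w z * invSq z) - U * B := by
      have : ∑ i, b i * (U * b i) = U * B := by
        rw [hB, Finset.mul_sum]
        exact Finset.sum_congr rfl fun i _ => by ring
      rw [this]
      ring
    rw [e] at h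
    rw [← h.2]
    have hnn : 0 ≤ᵐ[volume] fun z => w z * ∑ i, (invCoord i z - b i) ^ 2 := by
      filter_upwards [hw0] with z hz
      exact mul_nonneg hz (Finset.sum_nonneg fun i _ => sq_nonneg _)
    refine lt_of_le_of_ne (integral_nonneg_of_ae hnn) fun h0 => ?_
    have h1 := (integral_eq_zero_iff_of_nonneg_ae hnn h.1).1 h0.symm
    -- Zero variance would force `y = b` almost everywhere. Inversion being an involution, this
    -- leaves only the point `z = b/|b|²`, which is null.
    obtain ⟨z, ⟨hz1, hz2⟩, hz3⟩ := ((h1.and (hne 0)).and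
      (hne (WithLp.toLp 2 fun i => b i / B))).exists
    have h2 : ∑ i, (invCoord i z - b i) ^ 2 = 0 := by
      rcases mul_eq_zero.1 hz1 with h | h
      · exact absurd h (hw z hz2).ne'
      · exact h
    have h3 (i : Fin n) : invCoord i z = b i := by
      have := (Finset.sum_eq_zero_iff_of_nonneg fun i _ => sq_nonneg _).1 h2 i (Finset.mem_univ i)
      exact sub_eq_zero.1 (pow_eq_zero_iff two_ne_zero |>.1 this)
    refine hz3 ?_
    ext i
    have h4 : B = invSq z := by rw [hB, ← sum_invCoord_sq]; simp_rw [h3]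
    have h6 : invSq z ≠ 0 := by
      rw [invSq]
      exact inv_ne_zero (pow_ne_zero 2 (norm_ne_zero_iff.2 hz2))
    simp only [h4, ← h3, invCoord]
    field_simp
  · have h := HasMoment.sum (s := Finset.univ) fun i _ => mH i i
    simp_rw [← sq, sum_invCoord_sq] at h
    simp_rw [← sq]
    exact h.2.symm
  · have m3 (i : Fin n) : HasMoment w (fun z => invSq z * invCoord i z)
        (∫ z, w z * (invSq z * invCoord i z)) := by
      refine ⟨integrable_weight_mul hwm (measurable_invSq.mul (measurable_invCoord i))
        (hint 3 (by lia)) fun z => ?_, rfl⟩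
      rw [abs_mul, pow_succ]
      exact mul_le_mul (abs_invSq_le z) (abs_invCoord_le i z) (abs_nonneg _) (by positivity)
    have m4 : HasMoment w (fun z => invSq z ^ 2) (∫ z, w z * invSq z ^ 2) := by
      refine ⟨integrable_weight_mul hwm (measurable_invSq.pow_const 2) (hint 4 (by lia)) fun z => ?_,
        rfl⟩
      rw [invSq_eq, ← pow_mul, abs_of_nonneg (by positivity)]
    have h := ((((m4.add ((HasMoment.sum (s := Finset.univ) fun i _ =>
      HasMoment.sum (s := Finset.univ) fun j _ => (mH i j).const_mul (b i * b j)).const_mul 4)).add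
      (m0.const_mul (B ^ 2))).add ((HasMoment.sum (s := Finset.univ) fun i _ =>
        (m3 i).const_mul (b i)).const_mul (-4))).add (m2.const_mul (2 * B))).add
      ((HasMoment.sum (s := Finset.univ) fun i _ => (m1 i).const_mul (b i)).const_mul (-4 * B))
    have hpt (z : E n) : (∑ i, (invCoord i z - b i) ^ 2) ^ 2 =
        invSq z ^ 2 + 4 * ∑ i, ∑ j, b i * b j * (invCoord i z * invCoord j z) + B ^ 2 * 1
          + (-4) * ∑ i, b i * (invSq z * invCoord i z) + 2 * B * invSq z
          + (-4 * B) * ∑ i, b i * invCoord i z := by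
      have e1 : ∑ i, ∑ j, b i * b j * (invCoord i z * invCoord j z) =
          (∑ i, b i * invCoord i z) ^ 2 := by
        rw [sq, Finset.sum_mul_sum]
        exact Finset.sum_congr rfl fun i _ => Finset.sum_congr rfl fun j _ => by ring
      have e2 : ∑ i, b i * (invSq z * invCoord i z) = invSq z * ∑ i, b i * invCoord i z := by
        rw [Finset.mul_sum]
        exact Finset.sum_congr rfl fun i _ => by ring
      rw [hdev, e1, e2]
      ring
    simp_rw [← hpt] at h
    have hnn : 0 ≤ ∫ z, w z * (∑ i, (invCoord i z - b i) ^ 2) ^ 2 := by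
      refine integral_nonneg_of_ae ?_
      filter_upwards [hw0] with z hz
      exact mul_nonneg hz (sq_nonneg _)
    rw [h.2] at hnn
    have e : ∑ i, b i * (U * b i) = U * B := by
      rw [hB, Finset.mul_sum]
      exact Finset.sum_congr rfl fun i _ => by ring
    rw [e] at hnn
    linarith

variable {m : ℕ} {u : E n → ℝ}

/-- The two quantities are the brackets of `negLaplacian_rpow` and `negLaplacian_two_rpow` for `β =
(n-2)/a` and `β = (n-4)/a`, whose `β - 1` are `(2m-2)/a` and `(2m-4)/a`. -/
theorem derivative_inequalities (hm : 2 ≤ m) (hmn : 2 * m < n) (hu : ContDiff ℝ ∞ u)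
    (hpos : ∀ x, 0 < u x) (hf : ∀ x, 0 < negLaplacian^[m] u x)
    (hdecay : ∀ ε > 0, ∀ᶠ R : ℝ in atTop, ∫ x in Metric.ball 0 R, u x ≤ ε * R ^ n)
    {a : ℝ} (ha : a = n - 2 * m) :
    0 < -(u 0 * ∑ i, dirDerivs [stdVec i, stdVec i] u 0)
      - (2 * m - 2) / a * ∑ i, dirDeriv (stdVec i) u 0 ^ 2 ∧
    (3 ≤ m → 0 <
      u 0 ^ 3 * ∑ i, ∑ j, dirDerivs [stdVec i, stdVec i, stdVec j, stdVec j] u 0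
      + (2 * m - 4) / a * u 0 ^ 2 * ((∑ i, dirDerivs [stdVec i, stdVec i] u 0) ^ 2
        + 2 * ∑ i, ∑ j, dirDerivs [stdVec i, stdVec j] u 0 ^ 2
        + 4 * ∑ j, dirDeriv (stdVec j) u 0 * ∑ i, dirDerivs [stdVec j, stdVec i, stdVec i] u 0)
      + (2 * m - 4) / a * ((2 * m - 4) / a - 1) * u 0 *
        (2 * (∑ i, dirDeriv (stdVec i) u 0 ^ 2) * ∑ i, dirDerivs [stdVec i, stdVec i] u 0
        + 4 * ∑ i, ∑ j, dirDeriv (stdVec i) u 0 * dirDeriv (stdVec j) u 0 *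
          dirDerivs [stdVec i, stdVec j] u 0)
      + (2 * m - 4) / a * ((2 * m - 4) / a - 1) * ((2 * m - 4) / a - 2) *
        (∑ i, dirDeriv (stdVec i) u 0 ^ 2) ^ 2) := by
  have ha0 : 0 < a := by
    have : (2 * m : ℝ) < n := by exact_mod_cast hmn
    linarith
  have hm' : (2 : ℝ) ≤ m := by exact_mod_cast hm
  have : Nonempty (Fin n) := ⟨⟨0, by lia⟩⟩
  obtain ⟨w, hw, hwm, hint, hU, h1, h2, h34⟩ := exists_weight hm hmn hu hpos hf hdecay ha
  have hU0 : 0 < ∫ z, w z := hU ▸ hpos 0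
  obtain ⟨b, hb⟩ : ∃ b : Fin n → ℝ, ∀ i, ∫ z, w z * invCoord i z = (∫ z, w z) * b i :=
    ⟨fun i => (∫ z, w z * invCoord i z) / ∫ z, w z, fun i => by field_simp⟩
  obtain ⟨hW2, hH, hW4⟩ := exists_moments hw hwm (show 3 ≤ 2 * m by lia) hint hb
  set U := ∫ z, w z
  set S₂ := ∫ z, w z * invSq z
  set H : Fin n → Fin n → ℝ := fun i j => ∫ z, w z * (invCoord i z * invCoord j z) with hHdef
  change ∑ i, H i i = S₂ at hH
  have hHs (i j : Fin n) : H i j = H j i := by simp only [hHdef, mul_comm (invCoord i _)]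
  have hg (i : Fin n) : dirDeriv (stdVec i) u 0 = a * U * b i := by rw [h1, hb]; ring
  have hD (i j : Fin n) : dirDerivs [stdVec i, stdVec j] u 0 =
      a * (a + 2) * H i j - a * (if i = j then 1 else 0) * S₂ := by
    rw [hHs]
    simpa [eq_comm] using h2 j i
  have eG : ∑ i, dirDeriv (stdVec i) u 0 ^ 2 = a ^ 2 * U ^ 2 * ∑ i, b i ^ 2 := by
    rw [Finset.mul_sum]
    exact Finset.sum_congr rfl fun i _ => by rw [hg]; ring
  have hN : (n : ℝ) = a + (2 * m - 2) + 2 := by rw [ha]; ring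
  have eL : ∑ i, dirDerivs [stdVec i, stdVec i] u 0 = -(a * (2 * m - 2) * S₂) := by
    simp_rw [hD, Finset.sum_sub_distrib, ← Finset.mul_sum, hH]
    simp
    rw [hN]
    ring
  constructor
  · rw [eG, eL, hU]
    have h3 : 0 < a * U * (2 * m - 2) * (S₂ - U * ∑ i, b i ^ 2) :=
      mul_pos (mul_pos (by positivity) (by linarith)) hW2
    convert h3 using 1
    field_simp
  · intro hm3
    have hm3' : (3 : ℝ) ≤ m := by exact_mod_cast hm3
    obtain ⟨h3, h4⟩ := h34 hm3
    have h5 := hW4 (by lia)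
    set B := ∑ i, b i ^ 2 with hB
    set V : Fin n → ℝ := fun i => ∫ z, w z * (invSq z * invCoord i z)
    set S₄ := ∫ z, w z * invSq z ^ 2
    change 0 ≤ S₄ + 4 * (∑ i, ∑ j, b i * b j * H i j) - 3 * U * B ^ 2 - 4 * (∑ i, b i * V i)
      + 2 * B * S₂ at h5
    set bHb := ∑ i, ∑ j, b i * b j * H i j with hbHb
    set bV := ∑ i, b i * V i with hbV
    have eD : ∑ i, ∑ j, dirDerivs [stdVec i, stdVec j] u 0 ^ 2 =
        (a * (a + 2)) ^ 2 * (∑ i, ∑ j, H i j ^ 2) - 2 * a ^ 2 * (a + 2) * S₂ ^ 2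
          + n * a ^ 2 * S₂ ^ 2 := by
      have (i j : Fin n) : dirDerivs [stdVec i, stdVec j] u 0 ^ 2 = (a * (a + 2)) ^ 2 * H i j ^ 2
          + (if i = j then a ^ 2 * S₂ ^ 2 - 2 * a ^ 2 * (a + 2) * S₂ * H i j else 0) := by
        rw [hD]
        split_ifs <;> ring
      simp_rw [this, Finset.sum_add_distrib, ← Finset.mul_sum]
      simp only [Finset.sum_ite_eq, Finset.mem_univ, if_true, Finset.sum_sub_distrib,
        ← Finset.mul_sum, hH]
      simp
      ring
    have eV : ∑ j, dirDeriv (stdVec j) u 0 * ∑ i, dirDerivs [stdVec j, stdVec i, stdVec i] u 0 =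
        -(a ^ 2 * U * (2 * m - 2) * (a + 2) * bV) := by
      rw [hbV, Finset.mul_sum, ← Finset.sum_neg_distrib]
      exact Finset.sum_congr rfl fun i _ => by rw [hg, h3]; ring
    have eH : ∑ i, ∑ j, dirDeriv (stdVec i) u 0 * dirDeriv (stdVec j) u 0 *
          dirDerivs [stdVec i, stdVec j] u 0 = a ^ 2 * U ^ 2 * (a * (a + 2) * bHb - a * S₂ * B) := by
      have (i j : Fin n) : dirDeriv (stdVec i) u 0 * dirDeriv (stdVec j) u 0 *
          dirDerivs [stdVec i, stdVec j] u 0 = a ^ 2 * U ^ 2 * (a * (a + 2)) * (b i * b j * H i j)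
          - (if i = j then a ^ 2 * U ^ 2 * (a * S₂) * (b i * b j) else 0) := by
        rw [hg, hg, hD]
        split_ifs <;> ring
      simp_rw [this, Finset.sum_sub_distrib, ← Finset.mul_sum]
      simp only [Finset.sum_ite_eq, Finset.mem_univ, if_true, ← Finset.mul_sum, ← sq]
      ring
    -- Squared Frobenius norm of `a(a+2) Σ - a (tr Σ) I`, where `Σ = H - U b bᵀ` is the centred
    -- second-moment matrix and `tr Σ = S₂ - U B`.
    have hT : 0 ≤ (a * (a + 2)) ^ 2 * ((∑ i, ∑ j, H i j ^ 2) - 2 * U * bHb + U ^ 2 * B ^ 2)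
        - 2 * a ^ 2 * (a + 2) * (S₂ - U * B) ^ 2 + a ^ 2 * (S₂ - U * B) ^ 2 * n := by
      have hnn : 0 ≤ ∑ i, ∑ j, (a * (a + 2) * (H i j - U * (b i * b j))
          - (if i = j then a * (S₂ - U * B) else 0)) ^ 2 :=
        Finset.sum_nonneg fun i _ => Finset.sum_nonneg fun j _ => sq_nonneg _
      have (i j : Fin n) : (a * (a + 2) * (H i j - U * (b i * b j))
          - (if i = j then a * (S₂ - U * B) else 0)) ^ 2 =
          (a * (a + 2)) ^ 2 * H i j ^ 2 - (a * (a + 2)) ^ 2 * (2 * U) * (b i * b j * H i j)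
          + (a * (a + 2)) ^ 2 * U ^ 2 * (b i ^ 2 * b j ^ 2)
          + (if i = j then a ^ 2 * (S₂ - U * B) ^ 2
            - 2 * a ^ 2 * (a + 2) * (S₂ - U * B) * (H i j - U * (b i * b j)) else 0) := by
        split_ifs <;> ring
      simp_rw [this, Finset.sum_add_distrib, Finset.sum_sub_distrib, ← Finset.mul_sum] at hnn
      simp only [Finset.sum_ite_eq, Finset.mem_univ, if_true, Finset.sum_sub_distrib,
        ← Finset.mul_sum, ← Finset.sum_mul, hH, ← sq, ← hB, ← hbHb] at hnn
      simp only [Finset.sum_const, Finset.card_univ, Fintype.card_fin, nsmul_eq_mul] at hnn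
      linarith
    have hfin := quartic_pos ha0 (show 2 < 2 * (m : ℝ) - 2 by linarith) hU0 hN hW2 h5 hT
    rw [eG, eL, eD, eV, eH, h4, hU]
    rw [show 2 * (m : ℝ) - 2 - 2 = 2 * m - 4 by ring] at hfin
    exact hfin

end MomentInequalities

/-! ### Expansion of `(-Δ)^k u^β` for `k = 1, 2`, and of the scalar curvature. -/

section Curvature

variable {n : ℕ} {u : E n → ℝ}

/-! ### Powers of a positive function -/

lemma contDiff_rpow (hu : ContDiff ℝ ∞ u) (hpos : ∀ x, 0 < u x) (β : ℝ) :
    ContDiff ℝ ∞ fun x => u x ^ β :=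
  hu.rpow_const_of_ne fun x => (hpos x).ne'

lemma dirDeriv_rpow (hu : ContDiff ℝ ∞ u) (hpos : ∀ x, 0 < u x) (β : ℝ) (v : E n) :
    dirDeriv v (fun x => u x ^ β) = fun x => β * (u x ^ (β - 1) * dirDeriv v u x) := by
  ext x
  rw [dirDeriv, ((hu.differentiable (by simp) x).hasFDerivAt.rpow_const (p := β)
    (Or.inl (hpos x).ne')).fderiv]
  simp [dirDeriv]
  ring

lemma dirDeriv_dirDeriv_rpow (hu : ContDiff ℝ ∞ u) (hpos : ∀ x, 0 < u x) (β : ℝ) (v : E n) :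
    dirDeriv v (dirDeriv v fun x => u x ^ β) = fun x => β * (u x ^ (β - 1) * dirDeriv v (dirDeriv v u) x)
      + β * (β - 1) * (u x ^ (β - 2) * (dirDeriv v u x * dirDeriv v u x)) := by
  have h1 := contDiff_rpow hu hpos (β - 1)
  have h2 := contDiff_dirDeriv hu v
  rw [dirDeriv_rpow hu hpos, dirDeriv_const_mul (h1.mul h2), dirDeriv_mul h1 h2,
    dirDeriv_rpow hu hpos]
  ext x
  rw [show β - 1 - 1 = β - 2 by ring]
  ring

lemma dirDeriv_dirDeriv_mul {f g : E n → ℝ} (hf : ContDiff ℝ ∞ f) (hg : ContDiff ℝ ∞ g) (v : E n) :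
    dirDeriv v (dirDeriv v fun x => f x * g x) = fun x => f x * dirDeriv v (dirDeriv v g) x
      + 2 * (dirDeriv v f x * dirDeriv v g x) + dirDeriv v (dirDeriv v f) x * g x := by
  have hf' := contDiff_dirDeriv hf v
  have hg' := contDiff_dirDeriv hg v
  rw [dirDeriv_mul hf hg, dirDeriv_add (hf.mul hg') (hf'.mul hg), dirDeriv_mul hf hg',
    dirDeriv_mul hf' hg]
  ext x
  ring

lemma negLaplacian_rpow (hu : ContDiff ℝ ∞ u) (hpos : ∀ x, 0 < u x) (β : ℝ) (x : E n) :
    negLaplacian (fun x => u x ^ β) x = β * u x ^ (β - 2) *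
      (-(u x * ∑ i, dirDerivs [stdVec i, stdVec i] u x)
        - (β - 1) * ∑ i, dirDeriv (stdVec i) u x ^ 2) := by
  rw [negLaplacian_eq_sum (contDiff_rpow hu hpos β)]
  simp_rw [dirDeriv_dirDeriv_rpow hu hpos, Finset.sum_add_distrib, ← Finset.mul_sum, ← sq]
  have h : u x ^ (β - 1) = u x ^ (β - 2) * u x := by
    rw [show β - 1 = β - 2 + 1 by ring, Real.rpow_add (hpos x), Real.rpow_one]
  rw [h]
  simp only [dirDerivs_cons, dirDerivs_nil]
  ring

lemma dirDerivs_four_rpow (hu : ContDiff ℝ ∞ u) (hpos : ∀ x, 0 < u x) (β : ℝ) (v w x : E n) :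
    dirDerivs [v, v, w, w] (fun x => u x ^ β) x = β * u x ^ (β - 4) *
      (u x ^ 3 * dirDerivs [v, v, w, w] u x
      + (β - 1) * u x ^ 2 * (dirDerivs [v, v] u x * dirDerivs [w, w] u x
        + 2 * dirDerivs [v, w] u x ^ 2
        + 2 * (dirDeriv v u x * dirDerivs [v, w, w] u x)
        + 2 * (dirDeriv w u x * dirDerivs [w, v, v] u x))
      + (β - 1) * (β - 2) * u x * (dirDeriv v u x ^ 2 * dirDerivs [w, w] u x
        + dirDeriv w u x ^ 2 * dirDerivs [v, v] u x
        + 4 * (dirDeriv v u x * dirDeriv w u x * dirDerivs [v, w] u x))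
      + (β - 1) * (β - 2) * (β - 3) * (dirDeriv v u x ^ 2 * dirDeriv w u x ^ 2)) := by
  have hw := contDiff_dirDeriv hu w
  have hww := contDiff_dirDeriv hw w
  have h1 := contDiff_rpow hu hpos (β - 1)
  have h2 := contDiff_rpow hu hpos (β - 2)
  have e (f g : E n → ℝ) (hf : ContDiff ℝ ∞ f) (hg : ContDiff ℝ ∞ g) (c d : ℝ) :
      dirDeriv v (dirDeriv v fun x => c * f x + d * g x) =
        fun x => c * dirDeriv v (dirDeriv v f) x + d * dirDeriv v (dirDeriv v g) x := by
    rw [dirDeriv_add (contDiff_const.mul hf) (contDiff_const.mul hg), dirDeriv_const_mul hf,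
      dirDeriv_const_mul hg, dirDeriv_add (contDiff_const.mul (contDiff_dirDeriv hf v))
      (contDiff_const.mul (contDiff_dirDeriv hg v)), dirDeriv_const_mul (contDiff_dirDeriv hf v),
      dirDeriv_const_mul (contDiff_dirDeriv hg v)]
  have hp : dirDerivs [w, v, v] u = dirDerivs [v, v, w] u :=
    dirDerivs_perm hu (by
      exact (List.Perm.swap v w [v]).trans (List.Perm.cons v (List.Perm.swap v w [])))
  simp only [dirDerivs_cons, dirDerivs_nil] at hp ⊢
  rw [dirDeriv_dirDeriv_rpow hu hpos β w, e _ _ (h1.mul hww) (h2.mul (hw.mul hw)),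
    dirDeriv_dirDeriv_mul h1 hww, dirDeriv_dirDeriv_mul h2 (hw.mul hw),
    dirDeriv_dirDeriv_mul hw hw, dirDeriv_mul hw hw, dirDeriv_dirDeriv_rpow hu hpos,
    dirDeriv_dirDeriv_rpow hu hpos, dirDeriv_rpow hu hpos, dirDeriv_rpow hu hpos, hp]
  have e1 : u x ^ (β - 1) = u x ^ (β - 4) * u x ^ 3 := by
    rw [show β - 1 = β - 4 + (3 : ℕ) by push_cast; ring, Real.rpow_add (hpos x), Real.rpow_natCast]
  have e2 : u x ^ (β - 2) = u x ^ (β - 4) * u x ^ 2 := by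
    rw [show β - 2 = β - 4 + (2 : ℕ) by push_cast; ring, Real.rpow_add (hpos x), Real.rpow_natCast]
  have e3 : u x ^ (β - 3) = u x ^ (β - 4) * u x := by
    rw [show β - 3 = β - 4 + 1 by ring, Real.rpow_add (hpos x), Real.rpow_one]
  rw [show β - 1 - 1 = β - 2 by ring, show β - 1 - 2 = β - 3 by ring,
    show β - 2 - 1 = β - 3 by ring, show β - 2 - 2 = β - 4 by ring]
  simp only [e1, e2, e3]
  ring

lemma negLaplacian_two_eq_sum {f : E n → ℝ} (hf : ContDiff ℝ ∞ f) (x : E n) :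
    negLaplacian^[2] f x =
      ∑ i, ∑ j, dirDerivs [stdVec i, stdVec i, stdVec j, stdVec j] f x := by
  have h (j : Fin n) := contDiff_dirDerivs hf [stdVec j, stdVec j]
  have h' (i j : Fin n) := contDiff_dirDerivs hf [stdVec i, stdVec j, stdVec j]
  simp only [dirDerivs_cons, dirDerivs_nil] at h h'
  rw [Function.iterate_succ_apply, Function.iterate_one, negLaplacian_eq_sum hf,
    negLaplacian_eq_sum (ContDiff.sum fun i _ => h i).neg]
  simp_rw [dirDeriv_neg, dirDeriv_sum _ fun j _ => h j]
  rw [← Finset.sum_neg_distrib]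
  refine Finset.sum_congr rfl fun i _ => ?_
  rw [neg_neg, dirDeriv_sum _ fun j _ => h' i j]
  rfl

lemma negLaplacian_two_rpow (hu : ContDiff ℝ ∞ u) (hpos : ∀ x, 0 < u x) (β : ℝ) (x : E n) :
    negLaplacian^[2] (fun x => u x ^ β) x = β * u x ^ (β - 4) *
      (u x ^ 3 * ∑ i, ∑ j, dirDerivs [stdVec i, stdVec i, stdVec j, stdVec j] u x
      + (β - 1) * u x ^ 2 * ((∑ i, dirDerivs [stdVec i, stdVec i] u x) ^ 2
        + 2 * ∑ i, ∑ j, dirDerivs [stdVec i, stdVec j] u x ^ 2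
        + 4 * ∑ j, dirDeriv (stdVec j) u x * ∑ i, dirDerivs [stdVec j, stdVec i, stdVec i] u x)
      + (β - 1) * (β - 1 - 1) * u x *
        (2 * (∑ i, dirDeriv (stdVec i) u x ^ 2) * ∑ i, dirDerivs [stdVec i, stdVec i] u x
        + 4 * ∑ i, ∑ j, dirDeriv (stdVec i) u x * dirDeriv (stdVec j) u x *
          dirDerivs [stdVec i, stdVec j] u x)
      + (β - 1) * (β - 1 - 1) * (β - 1 - 2) * (∑ i, dirDeriv (stdVec i) u x ^ 2) ^ 2) := by
  rw [negLaplacian_two_eq_sum (contDiff_rpow hu hpos β)]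
  simp_rw [dirDerivs_four_rpow hu hpos β]
  simp only [← Finset.mul_sum, Finset.sum_add_distrib]
  have s1 : ∑ i, ∑ j, dirDeriv (stdVec j) u x * dirDerivs [stdVec j, stdVec i, stdVec i] u x =
      ∑ j, dirDeriv (stdVec j) u x * ∑ i, dirDerivs [stdVec j, stdVec i, stdVec i] u x := by
    rw [Finset.sum_comm]
    simp_rw [Finset.mul_sum]
  simp only [s1, ← Finset.sum_mul, ← Finset.mul_sum]
  ring

/-! ### The scalar curvature of a conformally flat metric -/

lemma conformalMetric_inv (m : ℕ) (hpos : ∀ x, 0 < u x) (x : E n) (i j : Fin n) :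
    (conformalMetric n m u x)⁻¹ i j =
      if i = j then (u x ^ (4 / ((n : ℝ) - 2 * m)))⁻¹ else 0 := by
  have h : (u x ^ (4 / ((n : ℝ) - 2 * m))) ≠ 0 := (Real.rpow_pos_of_pos (hpos x) _).ne'
  have : (conformalMetric n m u x)⁻¹ =
      (u x ^ (4 / ((n : ℝ) - 2 * m)))⁻¹ • (1 : Matrix (Fin n) (Fin n) ℝ) := by
    refine Matrix.inv_eq_right_inv ?_
    rw [conformalMetric, smul_mul_smul_comm, mul_inv_cancel₀ h, one_smul, one_mul]
  rw [this, Matrix.smul_apply, Matrix.one_apply]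
  simp

lemma partialDeriv_conformalMetric (m : ℕ) (hu : ContDiff ℝ ∞ u) (hpos : ∀ x, 0 < u x) (x : E n)
    (i j k : Fin n) :
    partialDeriv k (fun y => conformalMetric n m u y i j) x =
      if i = j then 4 / ((n : ℝ) - 2 * m) * (u x ^ (4 / ((n : ℝ) - 2 * m)) * ((u x)⁻¹ *
        dirDeriv (stdVec k) u x)) else 0 := by
  have h : u x ^ (4 / ((n : ℝ) - 2 * m) - 1) = u x ^ (4 / ((n : ℝ) - 2 * m)) * (u x)⁻¹ := by
    rw [Real.rpow_sub_one (hpos x).ne', div_eq_mul_inv]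
  simp only [conformalMetric, Matrix.smul_apply, Matrix.one_apply]
  split_ifs with hij
  · have := congrFun (dirDeriv_rpow hu hpos (4 / ((n : ℝ) - 2 * m)) (stdVec k)) x
    rw [h] at this
    simp only [smul_eq_mul, mul_one]
    rw [mul_assoc] at this
    exact this
  · simp [partialDeriv]

lemma christoffel_conformalMetric (m : ℕ) (hu : ContDiff ℝ ∞ u) (hpos : ∀ x, 0 < u x)
    (k i j : Fin n) :
    christoffel (conformalMetric n m u) k i j = fun x =>
      2 / ((n : ℝ) - 2 * m) * ((if j = k then 1 else 0) * ((u x)⁻¹ * dirDeriv (stdVec i) u x)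
        + (if i = k then 1 else 0) * ((u x)⁻¹ * dirDeriv (stdVec j) u x)
        - (if i = j then 1 else 0) * ((u x)⁻¹ * dirDeriv (stdVec k) u x)) := by
  ext x
  have h : (u x ^ (4 / ((n : ℝ) - 2 * m))) ≠ 0 := (Real.rpow_pos_of_pos (hpos x) _).ne'
  simp only [christoffel, conformalMetric_inv m hpos, partialDeriv_conformalMetric m hu hpos,
    ite_mul, zero_mul, Finset.sum_ite_eq, Finset.mem_univ, if_true]
  have h4 : 4 / ((n : ℝ) - 2 * m) = 2 * (2 / ((n : ℝ) - 2 * m)) := by ring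
  generalize u x ^ (4 / ((n : ℝ) - 2 * m)) = W at *
  generalize (u x)⁻¹ = t
  rw [h4]
  generalize 2 / ((n : ℝ) - 2 * m) = b
  split_ifs <;> field_simp <;> ring

/-- Write the metric as `e^(2ψ)|dx|²` with `∂_i ψ = b φ_i`, `b = 2/(n-2m)`, `φ_i = ∂_i u / u`. The
inverse metric is diagonal, so only diagonal Ricci entries are computed. The resulting bracket is
the one in `negLaplacian_rpow` for `Q⁽²⁾`. -/
lemma scalarCurvature_conformalMetric {m : ℕ} (hmn : 2 * m < n) (hu : ContDiff ℝ ∞ u)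
    (hpos : ∀ x, 0 < u x) (x : E n) :
    scalarCurvature (conformalMetric n m u) x =
      (n - 1) * (4 / ((n : ℝ) - 2 * m)) * (u x ^ (4 / ((n : ℝ) - 2 * m)))⁻¹ * (u x ^ 2)⁻¹ *
        (-(u x * ∑ i, dirDerivs [stdVec i, stdVec i] u x)
          - (2 * m - 2) / ((n : ℝ) - 2 * m) * ∑ i, dirDeriv (stdVec i) u x ^ 2) := by
  have ha : (n : ℝ) - 2 * m ≠ 0 := by
    have : (2 * m : ℝ) < n := by exact_mod_cast hmn
    linarith
  set φ : Fin n → E n → ℝ := fun i x => (u x)⁻¹ * dirDeriv (stdVec i) u x with hφ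
  have hinv : ContDiff ℝ ∞ fun x => (u x)⁻¹ := hu.inv fun x => (hpos x).ne'
  have hφs (i : Fin n) : ContDiff ℝ ∞ (φ i) := hinv.mul (contDiff_dirDeriv hu _)
  have hΓ (k i j : Fin n) : christoffel (conformalMetric n m u) k i j = fun x =>
      2 / ((n : ℝ) - 2 * m) * ((if j = k then 1 else 0) * φ i x + (if i = k then 1 else 0) * φ j x
        - (if i = j then 1 else 0) * φ k x) := christoffel_conformalMetric m hu hpos k i j
  have hdΓ (l k i j : Fin n) : partialDeriv l (christoffel (conformalMetric n m u) k i j) x =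
      2 / ((n : ℝ) - 2 * m) * ((if j = k then 1 else 0) * dirDeriv (stdVec l) (φ i) x
        + (if i = k then 1 else 0) * dirDeriv (stdVec l) (φ j) x
        - (if i = j then 1 else 0) * dirDeriv (stdVec l) (φ k) x) := by
    change dirDeriv (stdVec l) _ x = _
    rw [hΓ, dirDeriv_const_mul (((contDiff_const.mul (hφs i)).add (contDiff_const.mul (hφs j))).sub
      (contDiff_const.mul (hφs k))), dirDeriv_sub ((contDiff_const.mul (hφs i)).add
      (contDiff_const.mul (hφs j))) (contDiff_const.mul (hφs k)), dirDeriv_add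
      (contDiff_const.mul (hφs i)) (contDiff_const.mul (hφs j)), dirDeriv_const_mul (hφs i),
      dirDeriv_const_mul (hφs j), dirDeriv_const_mul (hφs k)]
  have hdφ (k : Fin n) : dirDeriv (stdVec k) (φ k) x =
      (u x)⁻¹ * dirDerivs [stdVec k, stdVec k] u x - (u x ^ 2)⁻¹ * dirDeriv (stdVec k) u x ^ 2 := by
    have h1 : dirDeriv (stdVec k) (fun x => (u x)⁻¹) x = -(u x ^ 2)⁻¹ * dirDeriv (stdVec k) u x := by
      have := dirDeriv_rpow hu hpos (-1) (stdVec k)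
      simp_rw [Real.rpow_neg_one] at this
      rw [this]
      simp only [show (-1 - 1 : ℝ) = -(2 : ℕ) by norm_num, Real.rpow_neg (hpos x).le,
        Real.rpow_natCast]
      ring
    rw [hφ, dirDeriv_mul hinv (contDiff_dirDeriv hu _)]
    simp only [h1, dirDerivs_cons, dirDerivs_nil]
    ring
  set b := 2 / ((n : ℝ) - 2 * m) with hb
  have hric (i : Fin n) : ricci (conformalMetric n m u) i i x =
      b * (2 * dirDeriv (stdVec i) (φ i) x - (∑ k, dirDeriv (stdVec k) (φ k) x)
        - n * dirDeriv (stdVec i) (φ i) x)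
      + b ^ 2 * ((n - 2) * φ i x ^ 2 - (n - 2) * ∑ k, φ k x ^ 2) := by
    have h1 (k : Fin n) : partialDeriv k (christoffel (conformalMetric n m u) k i i) x
        - partialDeriv i (christoffel (conformalMetric n m u) k i k) x =
        b * ((if i = k then 2 * dirDeriv (stdVec i) (φ i) x else 0) - dirDeriv (stdVec k) (φ k) x
          - dirDeriv (stdVec i) (φ i) x) := by
      rw [hdΓ, hdΓ]
      by_cases hik : i = k
      · subst hik
        simp only [if_true]
        ring
      · simp only [hik, if_true, if_false]
        ring
    have h2 (k l : Fin n) : christoffel (conformalMetric n m u) k k l x *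
          christoffel (conformalMetric n m u) l i i x
        - christoffel (conformalMetric n m u) k i l x *
          christoffel (conformalMetric n m u) l i k x =
        b ^ 2 * ((if i = l then 2 * φ i x ^ 2 else 0) - φ l x ^ 2
          - (if l = k then φ i x ^ 2 else 0) + (if i = k then φ l x ^ 2 else 0)
          + (if i = l then φ k x ^ 2 else 0)
          - (if i = k then (if i = l then 2 * φ i x ^ 2 else 0) else 0)) := by
      simp only [hΓ]
      by_cases hik : i = k
      · subst hik
        by_cases hil : i = l
        · subst hil
          simp only [if_true]
          ring
        · simp only [hil, Ne.symm hil, if_true, if_false]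
          ring
      · by_cases hil : i = l
        · subst hil
          simp only [hik, Ne.symm hik, if_true, if_false]
          ring
        · by_cases hlk : l = k
          · subst hlk
            simp only [hil, if_true, if_false]
            ring
          · simp only [hik, hil, hlk, Ne.symm hlk, if_true, if_false]
            ring
    simp only [ricci, h1, h2]
    simp only [Finset.sum_add_distrib, Finset.sum_sub_distrib, ← Finset.mul_sum, Finset.sum_ite_eq,
      Finset.sum_ite_eq', Finset.sum_ite_irrel, Finset.sum_const_zero, Finset.mem_univ, if_true, Finset.sum_const,
      Finset.card_univ, Fintype.card_fin, nsmul_eq_mul]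
    ring
  have hS : ∑ k, φ k x ^ 2 = (u x ^ 2)⁻¹ * ∑ i, dirDeriv (stdVec i) u x ^ 2 := by
    rw [Finset.mul_sum]
    refine Finset.sum_congr rfl fun i _ => ?_
    simp only [hφ, mul_pow, inv_pow]
  simp only [scalarCurvature, conformalMetric_inv m hpos, ite_mul, zero_mul, Finset.sum_ite_eq,
    Finset.mem_univ, if_true, hric]
  simp only [← Finset.mul_sum, Finset.sum_add_distrib, Finset.sum_sub_distrib, hS, hdφ,
    Finset.sum_const, Finset.card_univ, Fintype.card_fin, nsmul_eq_mul]
  have := hpos x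
  rw [hb]
  field_simp
  ring

end Curvature

/-! ### Assembly: lower bound for `Q` on balls, then translation to an arbitrary point. -/

section Positivity

variable {n : ℕ}

/-! ### Positivity of the scalar curvature and of the fourth-order Q-curvature -/

/-- Far out the barrier applies and `s ≤ 0` lets `|z + x|` be replaced by `2R`. On the remaining
compact ball `Q` has a positive minimum, while `(2R)^s ≤ 1`. -/
lemma HasSlowDecayBarrier.exists_lower_bound {Q : E n → ℝ} {s : ℝ} (hQ : HasSlowDecayBarrier Q s)
    (hc : Continuous Q) (hpos : ∀ x, 0 < Q x) (hs : s ≤ 0) (x : E n) :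
    ∃ c, 0 < c ∧ ∀ᶠ R : ℝ in atTop, ∀ z, ‖z‖ ≤ R → c * R ^ s ≤ Q (z + x) := by
  obtain ⟨c₀, hc₀, R₀, hR₀⟩ := hQ
  obtain ⟨y₀, -, hy₀⟩ := (isCompact_closedBall (0 : E n) (max R₀ 1)).exists_isMinOn
    ⟨0, by simp⟩ hc.continuousOn
  refine ⟨min c₀ (Q y₀) * 2 ^ s, by have := hpos y₀; positivity, ?_⟩
  filter_upwards [eventually_ge_atTop (max 1 ‖x‖)] with R hR z hz
  have hR1 : 1 ≤ R := (le_max_left _ _).trans hR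
  have hzx : ‖z + x‖ ≤ 2 * R := (norm_add_le z x).trans (by linarith [(le_max_right 1 ‖x‖).trans hR])
  rw [mul_assoc, ← Real.mul_rpow (by norm_num) (by linarith)]
  have h0 : 0 ≤ (2 * R) ^ s := by positivity
  rcases le_or_gt (max R₀ 1) ‖z + x‖ with h | h
  · have h1 : 0 < ‖z + x‖ := by linarith [(le_max_right R₀ 1).trans h]
    calc min c₀ (Q y₀) * (2 * R) ^ s ≤ c₀ * (2 * R) ^ s := by gcongr; exact min_le_left _ _
      _ ≤ c₀ * ‖z + x‖ ^ s :=
        mul_le_mul_of_nonneg_left (Real.rpow_le_rpow_of_nonpos h1 hzx hs) hc₀.le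
      _ ≤ Q (z + x) := hR₀ _ ((le_max_left _ _).trans h)
  · have h1 : (2 * R) ^ s ≤ 1 := Real.rpow_le_one_of_one_le_of_nonpos (by linarith) hs
    calc min c₀ (Q y₀) * (2 * R) ^ s ≤ Q y₀ * 1 := by
          gcongr
          · exact (hpos _).le
          · exact min_le_right _ _
      _ ≤ Q (z + x) := by
          rw [mul_one]
          exact hy₀ (by simpa using h.le)

lemma continuous_qCurvature (m k : ℕ) {u : E n → ℝ} (hu : ContDiff ℝ ∞ u) (hpos : ∀ x, 0 < u x) :
    Continuous (qCurvature n m k u) :=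
  (contDiff_negLaplacian_iterate (contDiff_rpow hu hpos _) k).continuous.div
    (contDiff_rpow hu hpos _).continuous fun x => (Real.rpow_pos_of_pos (hpos x) _).ne'

lemma negLaplacian_iterate_eq_qCurvature_mul {m : ℕ} (hmn : 2 * m < n) {u : E n → ℝ}
    (hpos : ∀ x, 0 < u x) (x : E n) :
    negLaplacian^[m] u x =
      qCurvature n m m u x * u x ^ (((n : ℝ) + 2 * m) / ((n : ℝ) - 2 * m)) := by
  have ha : (n : ℝ) - 2 * m ≠ 0 := by
    have : (2 * m : ℝ) < n := by exact_mod_cast hmn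
    linarith
  rw [← negLaplacian_iterate_eq n m m u hpos x, div_self ha]
  simp_rw [Real.rpow_one]

/-- If `Q⁽²ᵐ⁾` is positive and has a slow decay barrier at infinity, then the scalar curvature,
`Q⁽²⁾` and `Q⁽⁴⁾` are positive. -/
theorem curvatures_pos {m : ℕ} (hm : 2 ≤ m) (hmn : 2 * m < n)
    {u : E n → ℝ} (hu : ContDiff ℝ ∞ u) (hupos : ∀ x, 0 < u x)
    (hQpos : ∀ x, 0 < qCurvature n m m u x)
    {s : ℝ} (hs : -(2 * (m : ℝ)) < s) (hs0 : s ≤ 0)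
    (hQ : HasSlowDecayBarrier (qCurvature n m m u) s) :
    ∀ x : E n,
      0 < scalarCurvature (conformalMetric n m u) x ∧
      0 < qCurvature n m 1 u x ∧
      0 < qCurvature n m 2 u x := by
  intro x
  have hm' : (2 : ℝ) ≤ m := by exact_mod_cast hm
  have hmn' : (2 * m : ℝ) < n := by exact_mod_cast hmn
  have ha0 : 0 < (n : ℝ) - 2 * m := by linarith
  -- The derivative inequalities hold at the origin, so they are applied to the translate `u(· +
  -- x)`.
  have hvs : ContDiff ℝ ∞ fun z => u (z + x) := by fun_prop
  have hvf (z : E n) : negLaplacian^[m] (fun z => u (z + x)) z = qCurvature n m m u (z + x) *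
      u (z + x) ^ (((n : ℝ) + 2 * m) / ((n : ℝ) - 2 * m)) := by
    rw [negLaplacian_iterate_comp_add hu]
    exact negLaplacian_iterate_eq_qCurvature_mul hmn hupos _
  obtain ⟨c, hc, hcQ⟩ := hQ.exists_lower_bound (continuous_qCurvature m m hu hupos) hQpos hs0 x
  have hdecay : ∀ ε > 0, ∀ᶠ R : ℝ in Filter.atTop,
      ∫ z in Metric.ball (0 : E n) R, u (z + x) ≤ ε * R ^ n := by
    intro ε hε
    refine integral_le_of_superlinear (p := ((n : ℝ) + 2 * m) / ((n : ℝ) - 2 * m)) hvs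
      (fun z => hupos _) ?_ hs hc ?_ hε
    · rw [one_lt_div ha0]
      linarith
    · filter_upwards [hcQ] with R hR z hz
      rw [hvf]
      exact mul_le_mul_of_nonneg_right (hR z hz) (Real.rpow_nonneg (hupos _).le _)
  have hvfpos (z : E n) : 0 < negLaplacian^[m] (fun z => u (z + x)) z := by
    rw [hvf]
    exact mul_pos (hQpos _) (Real.rpow_pos_of_pos (hupos _) _)
  obtain ⟨h2, h4⟩ := derivative_inequalities hm hmn hvs (fun z => hupos _) hvfpos hdecay rfl
  simp only [dirDerivs_comp_add u x, dirDeriv_comp_add u _ x, zero_add] at h2 h4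
  refine ⟨?_, ?_, ?_⟩
  · rw [scalarCurvature_conformalMetric hmn hu hupos]
    have h1 := hupos x
    have h3 := Real.rpow_pos_of_pos h1 (4 / ((n : ℝ) - 2 * m))
    have h5 : 0 < (n : ℝ) - 1 := by linarith
    exact mul_pos (by positivity) h2
  · refine div_pos ?_ (Real.rpow_pos_of_pos (hupos x) _)
    rw [Function.iterate_one, negLaplacian_rpow hu hupos]
    have e : ((n : ℝ) - 2 * (1 : ℕ)) / ((n : ℝ) - 2 * m) - 1 = (2 * m - 2) / ((n : ℝ) - 2 * m) := by
      field_simp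
      push_cast
      ring
    rw [e]
    refine mul_pos (mul_pos (div_pos ?_ ha0) (Real.rpow_pos_of_pos (hupos x) _)) h2
    push_cast
    linarith
  · rcases hm.eq_or_lt with rfl | hm3
    -- For `m = 2` the fourth-order curvature is the given `Q⁽²ᵐ⁾`.
    · exact hQpos x
    · refine div_pos ?_ (Real.rpow_pos_of_pos (hupos x) _)
      rw [negLaplacian_two_rpow hu hupos]
      have e : ((n : ℝ) - 2 * (2 : ℕ)) / ((n : ℝ) - 2 * m) - 1 =
          (2 * m - 4) / ((n : ℝ) - 2 * m) := by
        field_simp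
        push_cast
        ring
      rw [e]
      refine mul_pos (mul_pos (div_pos ?_ ha0) (Real.rpow_pos_of_pos (hupos x) _)) (h4 hm3)
      push_cast
      linarith

end Positivity

end ConformalQ

end

theorem theorem1 (n m : ℕ) (hm : 2 ≤ m) (hmn : 2 * m < n)
    (u : ConformalQ.E n → ℝ) (hu : ContDiff ℝ ∞ u) (hupos : ∀ x, 0 < u x)
    (hQpos : ∀ x, 0 < ConformalQ.qCurvature n m m u x)
    (s : ℝ) (hs : -(2 * (m : ℝ)) < s) (hs0 : s ≤ 0)
    (hQ : ConformalQ.HasSlowDecayBarrier (ConformalQ.qCurvature n m m u) s) :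
    ∀ x : ConformalQ.E n,
      0 < ConformalQ.scalarCurvature (ConformalQ.conformalMetric n m u) x ∧
      0 < ConformalQ.qCurvature n m 1 u x ∧
      0 < ConformalQ.qCurvature n m 2 u x := by
  exact ConformalQ.curvatures_pos hm hmn hu hupos hQpos hs hs0 hQ
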